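/- Let $q\ge 2$ be an integer, let $\mathbb F\in\{\mathbb R,\mathbb C,\mathbb H\}$ with $d:=\dim_{\mathbb R}\mathbb F\in\{1,2,4\}$, and let $G:=GL(q,\mathbb F)$ and $K:=U(q,\mathbb F)$. For $g\in G$ let $\sigma_{sing}(g)=(x_1\ge\dots\ge x_q>0)$ be the ordered vector of singular values of $g$ (the square roots of the eigenvalues of $g^*g$, counted with multiplicity), and let $\ln\sigma_{sing}(g):=(\ln x_1,\dots,\ln x_q)\in C_q^A:=\{t\in\mathbb R^q:\ t_1\ge\dots\ge t_q\}$. For a positive definite Hermitian $q\times q$ matrix $A=(a_{ij})$ over $\mathbb F$ let $\Delta_r(A):=\det\bigl((a_{ij})_{1\le i,j\le r}\bigr)>0$ (with the Dieudonné determinant if $\mathbb F=\mathbb H$, i.e. the square root of the determinant of the matrix considered as a complex matrix), and for $\mu\in\mathbb C^q$ let $$\Delta_\mu(A):=\Delta_1(A)^{\mu_1-\mu_2}\cdots\Delta_{q-1}(A)^{\mu_{q-1}-\mu_q}\,\Delta_q(A)^{\mu_q}.$$ Put $\rho_l:=\frac d2(q+1-2l)$ for $l=1,\dots,q$, $e^{2\underline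 t}:=\mathrm{diag}(e^{2t_1},\dots,e^{2t_q})$, and let $$\varphi_\lambda(t):=\int_K\Delta_{(i\lambda-\rho)/2}\bigl(u^{-1}e^{2\underline t}u\bigr)\,du\qquad(t\in\mathbb R^q,\ \lambda\in\mathbb C^q)$$ be the spherical functions, where $du$ is the normalized Haar measure of $K$. The moment function of first order is the map $m_{\mathbf 1}:\mathbb R^q\to\mathbb R^q$ with components $$m_{\mathbf 1}(t)_j:=\frac{\partial}{\partial\lambda_j}\varphi_{-i\rho-i\lambda}(t)\Big|_{\lambda=0}\qquad(j=1,\dots,q).$$ Let $(X_k)_{k\ge1}$ be i.i.d. $G$-valued random variables whose common distribution $\nu_G$ is $K$-biinvariant (i.e. invariant under $g\mapsto ugv$ for all $u,v\in K$), let $S_0:=I_q$ and $S_k:=X_1X_2\cdots X_k$, and let $\nu$ be the image of $\nu_G$ under $\ln\sigma_{sing}$, a probability measure on $C_q^A$. (1) If $\nu$ admits first moments, i.e. $\int|t_j|\,d\nu(t)<\infty$ for $j=1,\dots,q$, then $m_{\mathbf 1}$ is $\nu$-integrable, and with $m_{\mathbf 1}(\nu):=\int m_{\mathbf 1}(t)\,d\nu(t)\in\mathbb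 R^q$, $$\frac{\ln\sigma_{sing}(S_k)}{k}\longrightarrow m_{\mathbf 1}(\nu)\qquad\text{almost surely as }k\to\infty.$$ (2) If $\nu$ admits second moments, i.e. $\int t_j^2\,d\nu(t)<\infty$ for $j=1,\dots,q$, then for every $\epsilon>1/2$, $$\frac1{k^\epsilon}\bigl(\ln\sigma_{sing}(S_k)-k\cdot m_{\mathbf 1}(\nu)\bigr)\longrightarrow0\qquad\text{almost surely as }k\to\infty.$$ -/

import Mathlib

open MeasureTheory ProbabilityTheory Filter Topology
open scoped Quaternion

noncomputable section

namespace BiinvariantWalk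

/-- `𝔽` is one of the fields `ℝ`, `ℂ` or the skew field `ℍ`, with its usual conjugation `star`
(and, since it is finite dimensional over `ℝ`, with its usual topology). -/
class IsRealComplexOrQuaternion (𝔽 : Type*) [NormedDivisionRing 𝔽] [NormedAlgebra ℝ 𝔽]
    [StarRing 𝔽] : Prop where
  equiv : Nonempty (𝔽 ≃⋆ₐ[ℝ] ℝ) ∨ Nonempty (𝔽 ≃⋆ₐ[ℝ] ℂ) ∨ Nonempty (𝔽 ≃⋆ₐ[ℝ] ℍ[ℝ])

instance : IsRealComplexOrQuaternion ℝ := ⟨Or.inl ⟨StarAlgEquiv.refl ℝ ℝ⟩⟩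
instance : IsRealComplexOrQuaternion ℂ := ⟨Or.inr (Or.inl ⟨StarAlgEquiv.refl ℝ ℂ⟩)⟩
instance : IsRealComplexOrQuaternion ℍ[ℝ] := ⟨Or.inr (Or.inr ⟨StarAlgEquiv.refl ℝ ℍ[ℝ]⟩)⟩

/-- Matrices carry the Borel sigma-algebra of their entrywise topology. The group of invertible
matrices and the group of unitary matrices inherit their sigma-algebras from it. -/
instance instMeasurableSpaceMatrix {m n R : Type*} [TopologicalSpace R] :
    MeasurableSpace (Matrix m n R) := borel _

instance instBorelSpaceMatrix {m n R : Type*} [TopologicalSpace R] :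
    BorelSpace (Matrix m n R) := ⟨rfl⟩

section Topology

variable {𝔽 : Type*} [NormedDivisionRing 𝔽] [NormedAlgebra ℝ 𝔽] [StarRing 𝔽]

/-- Each of the three cases yields a linear homeomorphism onto a finite-dimensional C*-algebra. -/
theorem exists_model [h : IsRealComplexOrQuaternion 𝔽] :
    FiniteDimensional ℝ 𝔽 ∧ ContinuousStar 𝔽 ∧
      ∃ (N : 𝔽 → ℝ) (C : ℝ), (∀ a, ‖a‖ ≤ C * N a) ∧ (∀ a, 0 ≤ N a) ∧
        ∃ T : 𝔽 →+ ℝ, T 1 = 1 ∧ ∀ a, T (star a * a) = N a ^ 2 := by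
  rcases h.equiv with ⟨⟨e⟩⟩ | ⟨⟨e⟩⟩ | ⟨⟨e⟩⟩
  · have fd : FiniteDimensional ℝ 𝔽 := e.symm.toAlgEquiv.toLinearEquiv.finiteDimensional
    have c1 : Continuous e := e.toAlgEquiv.toLinearMap.continuous_of_finiteDimensional
    have c2 : Continuous e.symm := e.symm.toAlgEquiv.toLinearMap.continuous_of_finiteDimensional
    let L : ℝ →L[ℝ] 𝔽 := ⟨e.symm.toAlgEquiv.toLinearMap, c2⟩
    refine ⟨fd, ⟨?_⟩, fun a => ‖e a‖, ‖L‖, fun a => ?_, fun a => norm_nonneg _,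
      (e : 𝔽 →+ ℝ), by simp, fun a => ?_⟩
    · have : (star : 𝔽 → 𝔽) = fun a => e.symm (star (e a)) := by
        ext a; rw [← map_star, StarAlgEquiv.symm_apply_apply]
      rw [this]; fun_prop
    · have := L.le_opNorm (e a)
      simpa [L] using this
    · simp [map_star, sq]
  · have fd : FiniteDimensional ℝ 𝔽 := e.symm.toAlgEquiv.toLinearEquiv.finiteDimensional
    have c1 : Continuous e := e.toAlgEquiv.toLinearMap.continuous_of_finiteDimensional
    have c2 : Continuous e.symm := e.symm.toAlgEquiv.toLinearMap.continuous_of_finiteDimensional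
    let L : ℂ →L[ℝ] 𝔽 := ⟨e.symm.toAlgEquiv.toLinearMap, c2⟩
    refine ⟨fd, ⟨?_⟩, fun a => ‖e a‖, ‖L‖, fun a => ?_, fun a => norm_nonneg _,
      Complex.reAddGroupHom.comp (e : 𝔽 →+ ℂ), by simp, fun a => ?_⟩
    · have : (star : 𝔽 → 𝔽) = fun a => e.symm (star (e a)) := by
        ext a; rw [← map_star, StarAlgEquiv.symm_apply_apply]
      rw [this]; fun_prop
    · have := L.le_opNorm (e a)
      simpa [L] using this
    · rw [Complex.sq_norm, Complex.normSq_apply]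
      simp [map_star]
  · have fd : FiniteDimensional ℝ 𝔽 := e.symm.toAlgEquiv.toLinearEquiv.finiteDimensional
    have c1 : Continuous e := e.toAlgEquiv.toLinearMap.continuous_of_finiteDimensional
    have c2 : Continuous e.symm := e.symm.toAlgEquiv.toLinearMap.continuous_of_finiteDimensional
    let L : ℍ[ℝ] →L[ℝ] 𝔽 := ⟨e.symm.toAlgEquiv.toLinearMap, c2⟩
    refine ⟨fd, ⟨?_⟩, fun a => ‖e a‖, ‖L‖, fun a => ?_, fun a => norm_nonneg _,
      ⟨⟨fun a => (e a).re, by simp⟩, by simp⟩, by simp, fun a => ?_⟩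
    · have : (star : 𝔽 → 𝔽) = fun a => e.symm (star (e a)) := by
        ext a; rw [← map_star, StarAlgEquiv.symm_apply_apply]
      rw [this]; fun_prop
    · have := L.le_opNorm (e a)
      simpa [L] using this
    · have := Quaternion.normSq_eq_norm_mul_self (e a)
      simp only [AddMonoidHom.coe_mk, ZeroHom.coe_mk, map_mul, map_star]
      rw [Quaternion.star_mul_self, this, Quaternion.re_coe, sq]

instance instContinuousStar [IsRealComplexOrQuaternion 𝔽] : ContinuousStar 𝔽 :=
  (exists_model (𝔽 := 𝔽)).2.1

instance instFiniteDimensional [IsRealComplexOrQuaternion 𝔽] : FiniteDimensional ℝ 𝔽 :=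
  (exists_model (𝔽 := 𝔽)).1

end Topology

variable (𝔽 : Type*) [NormedDivisionRing 𝔽] [NormedAlgebra ℝ 𝔽] [StarRing 𝔽] (q : ℕ)

/-- The maximal compact subgroup `K = U(q, 𝔽)` of `GL(q, 𝔽)`. -/
abbrev UnitaryGroup : Type _ := unitary (Matrix (Fin q) (Fin q) 𝔽)

instance instCompactSpaceUnitaryGroup [IsRealComplexOrQuaternion 𝔽] :
    CompactSpace (UnitaryGroup 𝔽 q) := by
  obtain ⟨fd, -, N, C, hC, hN, T, hT1, hT⟩ := exists_model (𝔽 := 𝔽)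
  have : ProperSpace 𝔽 := FiniteDimensional.proper ℝ 𝔽
  have hcpt : IsCompact (Set.univ.pi fun _ : Fin q => Set.univ.pi fun _ : Fin q =>
      Metric.closedBall (0 : 𝔽) |C|) :=
    isCompact_univ_pi fun _ => isCompact_univ_pi fun _ => isCompact_closedBall _ _
  refine isCompact_iff_compactSpace.mp
    (IsCompact.of_isClosed_subset (X := Matrix (Fin q) (Fin q) 𝔽) hcpt isClosed_unitary ?_)
  intro u hu i _ j _
  rw [mem_closedBall_zero_iff]
  have h1 : star u * u = 1 := (Unitary.mem_iff.mp hu).1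
  have h2 : ∑ k, N (u k j) ^ 2 = 1 := by
    have h3 := congrArg T (congrFun (congrFun h1 j) j)
    simpa [Matrix.mul_apply, Matrix.star_apply, map_sum, hT, hT1] using h3
  have h4 : N (u i j) ^ 2 ≤ 1 := by
    rw [← h2]
    exact Finset.single_le_sum (f := fun k => N (u k j) ^ 2) (fun k _ => sq_nonneg _)
      (Finset.mem_univ i)
  have h5 : N (u i j) ≤ 1 := by nlinarith [hN (u i j)]
  calc ‖u i j‖ ≤ C * N (u i j) := hC _
    _ ≤ |C| * N (u i j) := mul_le_mul_of_nonneg_right (le_abs_self C) (hN _)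
    _ ≤ |C| * 1 := mul_le_mul_of_nonneg_left h5 (abs_nonneg C)
    _ = |C| := mul_one _

/-- The normalized Haar measure `du` on `K = U(q, 𝔽)`. -/
def haarUnitary [IsRealComplexOrQuaternion 𝔽] : Measure (UnitaryGroup 𝔽 q) :=
  Measure.haarMeasure ⊤

variable {𝔽 q}

/-- The diagonal matrix over `𝔽` with the real entries `x 0, …, x (q - 1)`. -/
def realDiag (x : Fin q → ℝ) : Matrix (Fin q) (Fin q) 𝔽 :=
  Matrix.diagonal fun i => algebraMap ℝ 𝔽 (x i)

/-- `x` lists the eigenvalues of the Hermitian matrix `A` over `𝔽` with multiplicities, in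
decreasing order: `A = u · diag(x) · u⁻¹` for some `u ∈ U(q, 𝔽)`. -/
def IsOrderedSpectrum (A : Matrix (Fin q) (Fin q) 𝔽) (x : Fin q → ℝ) : Prop :=
  Antitone x ∧ ∃ u : UnitaryGroup 𝔽 q,
    A = (u : Matrix (Fin q) (Fin q) 𝔽) * realDiag x * star (u : Matrix (Fin q) (Fin q) 𝔽)

open Classical in
/-- The ordered eigenvalues of a Hermitian matrix over `𝔽`; they exist by the spectral theorem. -/
def orderedSpectrum (A : Matrix (Fin q) (Fin q) 𝔽) : Fin q → ℝ :=
  if h : ∃ x, IsOrderedSpectrum A x then h.choose else 0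

/-- The singular spectrum `σ_sing(g)`: the square roots of the eigenvalues of `g* g`, ordered by
size. -/
def singularSpectrum (g : GL (Fin q) 𝔽) (j : Fin q) : ℝ :=
  Real.sqrt (orderedSpectrum
    (star (g : Matrix (Fin q) (Fin q) 𝔽) * (g : Matrix (Fin q) (Fin q) 𝔽)) j)

/-- `ln σ_sing(g)`, an element of the Weyl chamber of type `A`. -/
def logSingularSpectrum (g : GL (Fin q) 𝔽) (j : Fin q) : ℝ :=
  Real.log (singularSpectrum g j)

/-- The determinant of a positive definite Hermitian matrix `A` over `𝔽`, namely the `d`-th root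
of the determinant of the real linear map `v ↦ A v` on `𝔽 ^ r`, where `d = dim_ℝ 𝔽 ∈ {1, 2, 4}`.
For `𝔽 = ℝ, ℂ` this is the usual determinant of such a matrix, as the real determinant of a
complex matrix is the squared modulus of its determinant. For `𝔽 = ℍ` it is the Dieudonné
determinant, the square root of the determinant of `A` considered as a complex matrix. -/
def posDet {r : ℕ} (A : Matrix (Fin r) (Fin r) 𝔽) : ℝ :=
  (LinearMap.det ((LinearMap.pi fun i => ∑ j, LinearMap.mulLeft ℝ (A i j) ∘ₗ LinearMap.proj j) :
    (Fin r → 𝔽) →ₗ[ℝ] (Fin r → 𝔽))) ^ (1 / (Module.finrank ℝ 𝔽 : ℝ))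

/-- The principal minor of order `r + 1`, i.e. `Δ_{r+1}(A) = det ((a_ij)_{i, j ≤ r + 1})`. -/
def minor (A : Matrix (Fin q) (Fin q) 𝔽) (r : Fin q) : ℝ :=
  posDet (A.submatrix (Fin.castLE r.isLt : Fin (r + 1) → Fin q) (Fin.castLE r.isLt))

/-- The power function
`Δ_μ(A) = Δ_1(A)^(μ_1 - μ_2) ⋯ Δ_{q-1}(A)^(μ_{q-1} - μ_q) · Δ_q(A)^(μ_q)`. -/
def powerFunction (μ : Fin q → ℂ) (A : Matrix (Fin q) (Fin q) 𝔽) : ℂ :=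
  ∏ r : Fin q,
    (minor A r : ℂ) ^ (μ r - if h : (r : ℕ) + 1 < q then μ ⟨(r : ℕ) + 1, h⟩ else 0)

variable (𝔽) in
/-- The half sum of positive roots, `ρ_l = (d / 2) (q + 1 - 2 l)` for `l = 1, …, q`; here the
index `l : Fin q` starts from `0`. -/
def halfSum (l : Fin q) : ℝ :=
  (Module.finrank ℝ 𝔽 : ℝ) / 2 * ((q : ℝ) + 1 - 2 * ((l : ℕ) + 1 : ℝ))

variable (𝔽) in
/-- The spherical function of `(GL(q, 𝔽), U(q, 𝔽))` with spectral parameter `μ`,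
`φ_μ(t) = ∫_K Δ_{(iμ - ρ)/2}(u⁻¹ e^{2t} u) du`. -/
def spherical [IsRealComplexOrQuaternion 𝔽] (μ : Fin q → ℂ) (t : Fin q → ℝ) : ℂ :=
  ∫ u : UnitaryGroup 𝔽 q,
    powerFunction (fun l => (Complex.I * μ l - (halfSum 𝔽 l : ℂ)) / 2)
      (star (u : Matrix (Fin q) (Fin q) 𝔽) * realDiag (fun i => Real.exp (2 * t i)) *
        (u : Matrix (Fin q) (Fin q) 𝔽)) ∂(haarUnitary 𝔽 q)

variable (𝔽) in
/-- The vector-valued moment function of first order: its `j`-th entry is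
`∂/∂μ_j φ_{-iρ - iμ}(t)` at `μ = 0`. This is real, as `φ_{-iρ - iμ}(t)` is real for real `μ`. -/
def momentFunction [IsRealComplexOrQuaternion 𝔽] (t : Fin q → ℝ) (j : Fin q) : ℝ :=
  (deriv (fun s : ℝ => spherical 𝔽 (fun l => -Complex.I * (halfSum 𝔽 l : ℂ)
    - Complex.I * (Pi.single j s : Fin q → ℝ) l) t) 0).re

variable (𝔽) in
/-- The dispersion `m_1(ν) = ∫ m_1(t) dν(t)`. -/
def dispersion [IsRealComplexOrQuaternion 𝔽] (ν : Measure (Fin q → ℝ)) (j : Fin q) : ℝ :=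
  ∫ t, momentFunction 𝔽 t j ∂ν

/-- All usual first moments `∫ t_j dν(t)` exist. -/
def AdmitsFirstMoments (ν : Measure (Fin q → ℝ)) : Prop :=
  ∀ j, Integrable (fun t : Fin q → ℝ => t j) ν

/-- All usual second moments `∫ t_j ^ 2 dν(t)` exist. -/
def AdmitsSecondMoments (ν : Measure (Fin q → ℝ)) : Prop :=
  ∀ j, Integrable (fun t : Fin q → ℝ => t j ^ 2) ν

/-- A measure on `GL(q, 𝔽)` that is invariant under `g ↦ u g v` for all `u, v ∈ U(q, 𝔽)`. -/
def IsBiinvariant (νG : Measure (GL (Fin q) 𝔽)) : Prop :=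
  ∀ u v : UnitaryGroup 𝔽 q,
    νG.map (fun g => Unitary.toUnits u * g * Unitary.toUnits v) = νG

/-- The image of a measure on `G = GL(q, 𝔽)` under the canonical projection `ln σ_sing` of `G`
onto `G // K`, identified with the Weyl chamber in `ℝ ^ q`. -/
def radialPart (νG : Measure (GL (Fin q) 𝔽)) : Measure (Fin q → ℝ) :=
  νG.map logSingularSpectrum

/-- The random walk `S_0 = 1`, `S_{k+1} = S_k X_{k+1}`; here `X k` is the `(k+1)`-st increment. -/
def walk {Ω : Type*} (X : ℕ → Ω → GL (Fin q) 𝔽) : ℕ → Ω → GL (Fin q) 𝔽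
  | 0, _ => 1
  | k + 1, ω => walk X k ω * X k ω

end BiinvariantWalk

end

open BiinvariantWalk

/-!
Write `S_k = X_1 ⋯ X_k` and `L_r(g) = log Δ_r(g* g) / 2`. Then `L_r(S_k*)` differs from the sum of
the `r` largest logarithmic singular values of `S_k` by a defect whose second moment is bounded
uniformly in `k`: left `K`-invariance replaces `S_k*` by `S_k* u` with `u` Haar distributed, and by
Cauchy–Binet the defect is then controlled by the negative part of the logarithm of a minor of `u`,
which is square integrable because a small negative power of the minor is integrable. A bounded
second moment makes the defect `o(k ^ ε)` almost surely for every `ε > 1/2`.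

The process `L_r(S_k*)` itself is a random walk with i.i.d. increments: the `QR` decomposition turns
`L_r(S_{k+1}*) - L_r(S_k*)` into `L_r(X_{k+1}* u)` with a unitary `u` that depends only on the past,
and this has the law of `L_r(X_{k+1}*)` whatever `u` is. The classical strong law and the
Kolmogorov–Kronecker argument apply to it, and its drift is read off from the moment function, which
is the vector of differences of the means of `L_r(e^t u)` over Haar distributed `u`.
-/

noncomputable section

namespace BiinvariantWalk

open Matrix
open scoped ENNReal

section Scalars

section Transfer

variable {A R ι : Type*} [Ring A] [Algebra ℝ A] [StarRing A] [Ring R] [Algebra ℝ R] [StarRing R]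
  [Fintype ι] [DecidableEq ι]

theorem starModule_of_starAlgEquiv [StarModule ℝ R] (e : A ≃⋆ₐ[ℝ] R) : StarModule ℝ A where
  star_smul r a := EquivLike.injective e <| by simp only [map_star, map_smul, star_smul]

theorem exists_star_mul_self_eq_of_starAlgEquiv (e : A ≃⋆ₐ[ℝ] R)
    (hR : ∀ x : R, ∃ c : ℝ, 0 ≤ c ∧ star x * x = algebraMap ℝ R c) (a : A) :
    ∃ c : ℝ, 0 ≤ c ∧ star a * a = algebraMap ℝ A c := by
  obtain ⟨c, hc, h⟩ := hR (e a)
  refine ⟨c, hc, EquivLike.injective e ?_⟩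
  rw [map_mul, map_star, h]
  exact (e.toAlgEquiv.commutes c).symm

/-- If the coordinates in `b` are given by a symmetric form `B` for which left multiplication by
`star a` is adjoint to left multiplication by `a`, then `star` becomes transposition. -/
theorem leftMulMatrix_star_of_form (b : Module.Basis ι ℝ R) (B : R → R → ℝ)
    (hB : ∀ x y, B x y = B y x) (hadj : ∀ a x y, B x (star a * y) = B (a * x) y)
    (hb : ∀ x i, b.repr x i = B (b i) x) (a : R) :
    Algebra.leftMulMatrix b (star a) = (Algebra.leftMulMatrix b a)ᵀ := by
  ext i j
  rw [transpose_apply, Algebra.leftMulMatrix_eq_repr_mul, Algebra.leftMulMatrix_eq_repr_mul,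
    hb, hb, hadj, hB]

theorem leftMulMatrix_map_starAlgEquiv_symm (e : A ≃⋆ₐ[ℝ] R) (b : Module.Basis ι ℝ R) (a : A) :
    Algebra.leftMulMatrix (b.map e.symm.toAlgEquiv.toLinearEquiv) a
      = Algebra.leftMulMatrix b (e a) := by
  ext i j
  rw [Algebra.leftMulMatrix_eq_repr_mul, Algebra.leftMulMatrix_eq_repr_mul, Module.Basis.map_repr]
  change b.repr (e (a * e.symm (b j))) i = _
  rw [map_mul, StarAlgEquiv.apply_symm_apply]

theorem exists_basis_leftMulMatrix_star_of_starAlgEquiv {n : ℕ} (e : A ≃⋆ₐ[ℝ] R)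
    (b : Module.Basis (Fin n) ℝ R)
    (hb : ∀ x, Algebra.leftMulMatrix b (star x) = (Algebra.leftMulMatrix b x)ᵀ) :
    ∃ b : Module.Basis (Fin (Module.finrank ℝ A)) ℝ A,
      ∀ a, Algebra.leftMulMatrix b (star a) = (Algebra.leftMulMatrix b a)ᵀ := by
  let b' := b.map e.symm.toAlgEquiv.toLinearEquiv
  obtain rfl : Module.finrank ℝ A = n := by rw [Module.finrank_eq_card_basis b', Fintype.card_fin]
  refine ⟨b', fun a => ?_⟩
  rw [leftMulMatrix_map_starAlgEquiv_symm, leftMulMatrix_map_starAlgEquiv_symm, map_star, hb]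

end Transfer

variable (𝔽 : Type*) [NormedDivisionRing 𝔽] [NormedAlgebra ℝ 𝔽] [StarRing 𝔽]
  [h : IsRealComplexOrQuaternion 𝔽]

instance instStarModuleReal : StarModule ℝ 𝔽 := by
  have : StarModule ℝ ℍ[ℝ] := ⟨fun r x => Quaternion.star_smul r x⟩
  rcases h.equiv with ⟨⟨e⟩⟩ | ⟨⟨e⟩⟩ | ⟨⟨e⟩⟩ <;> exact starModule_of_starAlgEquiv e

theorem exists_basis_leftMulMatrix_star :
    ∃ b : Module.Basis (Fin (Module.finrank ℝ 𝔽)) ℝ 𝔽,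
      ∀ a, Algebra.leftMulMatrix b (star a) = (Algebra.leftMulMatrix b a)ᵀ := by
  rcases h.equiv with ⟨⟨e⟩⟩ | ⟨⟨e⟩⟩ | ⟨⟨e⟩⟩
  · refine exists_basis_leftMulMatrix_star_of_starAlgEquiv e (stdOrthonormalBasis ℝ ℝ).toBasis
      (leftMulMatrix_star_of_form _ (inner ℝ) (fun x y => real_inner_comm _ _) (fun a x y => ?_)
        fun x i => by simp [OrthonormalBasis.repr_apply_apply])
    simp; ring
  · refine exists_basis_leftMulMatrix_star_of_starAlgEquiv e (stdOrthonormalBasis ℝ ℂ).toBasis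
      (leftMulMatrix_star_of_form _ (inner ℝ) (fun x y => real_inner_comm _ _) (fun a x y => ?_)
        fun x i => by simp only [OrthonormalBasis.coe_toBasis_repr_apply,
          OrthonormalBasis.coe_toBasis, OrthonormalBasis.repr_apply_apply])
    simp [Complex.inner]; ring
  · refine exists_basis_leftMulMatrix_star_of_starAlgEquiv e (stdOrthonormalBasis ℝ ℍ[ℝ]).toBasis
      (leftMulMatrix_star_of_form _ (inner ℝ) (fun x y => real_inner_comm _ _) (fun a x y => ?_)
        fun x i => by simp only [OrthonormalBasis.coe_toBasis_repr_apply,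
          OrthonormalBasis.coe_toBasis, OrthonormalBasis.repr_apply_apply])
    simp [Quaternion.inner_def]; ring

variable {𝔽}

theorem exists_star_mul_self_eq (a : 𝔽) : ∃ c : ℝ, 0 ≤ c ∧ star a * a = algebraMap ℝ 𝔽 c := by
  rcases h.equiv with ⟨⟨e⟩⟩ | ⟨⟨e⟩⟩ | ⟨⟨e⟩⟩ <;>
    refine exists_star_mul_self_eq_of_starAlgEquiv e (fun x => ?_) a
  · exact ⟨x * x, mul_self_nonneg x, rfl⟩
  · exact ⟨Complex.normSq x, Complex.normSq_nonneg x, Complex.normSq_eq_conj_mul_self.symm⟩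
  · exact ⟨Quaternion.normSq x, Quaternion.normSq_nonneg, Quaternion.star_mul_self x⟩

theorem star_realDiag {q : ℕ} (x : Fin q → ℝ) :
    star (realDiag x : Matrix (Fin q) (Fin q) 𝔽) = realDiag x := by
  rw [realDiag, star_eq_conjTranspose, diagonal_conjTranspose]
  congr 1
  ext i
  rw [Pi.star_apply, ← algebraMap_star_comm, star_trivial]

end Scalars

section RealDet

variable {m n : Type*} [Fintype n] [DecidableEq n]

theorem one_le_det_one_add {P : Matrix n n ℝ} (hP : P.PosSemidef) : 1 ≤ (1 + P).det := by
  have hs := hP.1.spectral_theorem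
  rw [Unitary.conjStarAlgAut_apply] at hs
  set U := (hP.1.eigenvectorUnitary : Matrix n n ℝ)
  have hUU : U * star U = 1 := Unitary.coe_mul_star_self _
  have hconj : 1 + P = U * diagonal (fun i => 1 + hP.1.eigenvalues i) * star U := by
    conv_lhs => rw [hs, ← hUU]
    rw [← diagonal_add, diagonal_one, Matrix.mul_add, Matrix.add_mul, Matrix.mul_one]
    rfl
  have hdet : U.det * (star U).det = 1 := by rw [← det_mul, hUU, det_one]
  rw [hconj, det_mul, det_mul, mul_right_comm, hdet, one_mul, det_diagonal]
  exact Finset.one_le_prod fun i _ => le_add_of_nonneg_right (hP.eigenvalues_nonneg i)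

open scoped MatrixOrder ComplexOrder in
theorem det_le_det_of_posSemidef_sub {A B : Matrix n n ℝ} (hA : A.PosDef)
    (hBA : (B - A).PosSemidef) : A.det ≤ B.det := by
  obtain ⟨S, hS⟩ := CStarAlgebra.nonneg_iff_eq_star_mul_self.mp hA.posSemidef.nonneg
  have hSA : A.det = (Sᴴ).det * S.det := by rw [hS, det_mul, star_eq_conjTranspose]
  have hSd : IsUnit S.det :=
    isUnit_iff_ne_zero.mpr fun h => hA.det_pos.ne' (by rw [hSA, h, mul_zero])
  have hP : ((S⁻¹)ᴴ * (B - A) * S⁻¹).PosSemidef := hBA.conjTranspose_mul_mul_same _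
  have hSS : Sᴴ * (S⁻¹)ᴴ = 1 := by
    rw [← conjTranspose_mul, nonsing_inv_mul _ hSd, conjTranspose_one]
  have hB : B = Sᴴ * (1 + (S⁻¹)ᴴ * (B - A) * S⁻¹) * S := by
    have hcancel : Sᴴ * ((S⁻¹)ᴴ * (B - A) * S⁻¹) * S = B - A := by
      calc _ = (Sᴴ * (S⁻¹)ᴴ) * (B - A) * (S⁻¹ * S) := by simp only [Matrix.mul_assoc]
        _ = _ := by rw [hSS, nonsing_inv_mul _ hSd, Matrix.one_mul, Matrix.mul_one]
    rw [Matrix.mul_add, Matrix.add_mul, hcancel, Matrix.mul_one, ← star_eq_conjTranspose, ← hS,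
      add_sub_cancel]
  rw [hB, det_mul, det_mul, mul_right_comm, ← hSA]
  exact le_mul_of_one_le_right hA.det_pos.le (one_le_det_one_add hP)

theorem posSemidef_transpose_mul_diagonal_mul [Finite m] {d : n → ℝ} (hd : ∀ i, 0 ≤ d i)
    (J : Matrix n m ℝ) :
    (Jᵀ * diagonal d * J).PosSemidef := by
  simpa using (PosSemidef.diagonal hd).conjTranspose_mul_mul_same J

variable [Fintype m]

theorem posDef_transpose_mul_diagonal_mul {d : n → ℝ} (hd : ∀ i, 0 < d i) {J : Matrix n m ℝ}
    (hJ : Function.Injective J.mulVec) : (Jᵀ * diagonal d * J).PosDef := by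
  simpa using (PosDef.diagonal hd).conjTranspose_mul_mul_same hJ

omit [DecidableEq n] in
theorem mulVec_injective_of_transpose_mul_self [DecidableEq m] {J : Matrix n m ℝ}
    (hJ : Jᵀ * J = 1) :
    Function.Injective J.mulVec :=
  Function.LeftInverse.injective (g := Jᵀ.mulVec) fun v => by rw [mulVec_mulVec, hJ, one_mulVec]

variable [DecidableEq m]

theorem det_transpose_mul_diagonal_mul_mono {d e : n → ℝ} (hd : ∀ i, 0 < d i) (hde : d ≤ e)
    {J : Matrix n m ℝ} (hJ : Function.Injective J.mulVec) :
    (Jᵀ * diagonal d * J).det ≤ (Jᵀ * diagonal e * J).det := by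
  refine det_le_det_of_posSemidef_sub (posDef_transpose_mul_diagonal_mul hd hJ) ?_
  rw [← Matrix.sub_mul, ← Matrix.mul_sub, diagonal_sub]
  exact posSemidef_transpose_mul_diagonal_mul (fun i => sub_nonneg.mpr (hde i)) J

theorem det_one_add_transpose_mul_diagonal_mul_le {J : Matrix n m ℝ} (hJ : Jᵀ * J = 1) {y : n → ℝ}
    (hy : ∀ i, 0 ≤ y i) : (1 + Jᵀ * diagonal y * J).det ≤ ∏ i, (1 + y i) := by
  set F : Matrix n n ℝ := diagonal fun i => √(y i) with hF
  have hFt : Fᵀ = F := diagonal_transpose _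
  have hFF : F * F = diagonal y := by simp [hF, Real.mul_self_sqrt (hy _)]
  have hproj : (1 - J * Jᵀ).PosSemidef := by
    have hidem : (1 - J * Jᵀ)ᵀ * (1 - J * Jᵀ) = 1 - J * Jᵀ := by
      have : J * Jᵀ * (J * Jᵀ) = J * Jᵀ := by
        rw [Matrix.mul_assoc, ← Matrix.mul_assoc Jᵀ, hJ, Matrix.one_mul]
      simp [Matrix.sub_mul, Matrix.mul_sub, this]
    have := posSemidef_conjTranspose_mul_self (1 - J * Jᵀ)
    rwa [conjTranspose_eq_transpose_of_trivial, hidem] at this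
  have hgram : ((Jᵀ * F)ᵀ * (Jᵀ * F)).PosSemidef := by
    simpa using posSemidef_conjTranspose_mul_self (Jᵀ * F)
  calc (1 + Jᵀ * diagonal y * J).det = (1 + (Jᵀ * F)ᵀ * (Jᵀ * F)).det := by
        rw [← hFF, ← Matrix.mul_assoc, Matrix.mul_assoc _ F J, det_one_add_mul_comm, transpose_mul,
          transpose_transpose, hFt]
    _ ≤ (1 + F * F).det := by
        refine det_le_det_of_posSemidef_sub (PosDef.one.add_posSemidef hgram) ?_
        have hdiff : 1 + F * F - (1 + (Jᵀ * F)ᵀ * (Jᵀ * F)) = Fᵀ * (1 - J * Jᵀ) * F := by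
          simp only [Matrix.mul_sub, Matrix.sub_mul, Matrix.mul_one, transpose_mul,
            transpose_transpose, hFt, Matrix.mul_assoc]
          abel
        rw [hdiff, ← conjTranspose_eq_transpose_of_trivial]
        exact hproj.conjTranspose_mul_mul_same F
    _ = ∏ i, (1 + y i) := by rw [hFF, ← diagonal_one, diagonal_add, det_diagonal]

theorem det_transpose_mul_diagonal_mul_le_prod_max {J : Matrix n m ℝ} (hJ : Jᵀ * J = 1) {x : n → ℝ}
    (hx : ∀ i, 0 < x i) {c : ℝ} (hc : 0 < c) :
    (Jᵀ * diagonal x * J).det ≤ c ^ Fintype.card m * ∏ i, max (x i / c) 1 := by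
  set y : n → ℝ := fun i => max (x i / c) 1 - 1
  have hxy : x ≤ fun i => c * (1 + y i) := fun i => by
    change x i ≤ c * (1 + (max (x i / c) 1 - 1))
    rw [add_sub_cancel, mul_max_of_nonneg _ _ hc.le, mul_div_cancel₀ _ hc.ne']
    exact le_max_left _ _
  have hfactor : Jᵀ * diagonal (fun i => c * (1 + y i)) * J = c • (1 + Jᵀ * diagonal y * J) := by
    rw [show diagonal (fun i => c * (1 + y i)) = c • (1 + diagonal y) by
      rw [← diagonal_one, diagonal_add, ← diagonal_smul]; rfl]
    simp [Matrix.mul_add, Matrix.add_mul, hJ]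
  calc (Jᵀ * diagonal x * J).det ≤ (Jᵀ * diagonal (fun i => c * (1 + y i)) * J).det :=
        det_transpose_mul_diagonal_mul_mono hx hxy (mulVec_injective_of_transpose_mul_self hJ)
    _ = c ^ Fintype.card m * (1 + Jᵀ * diagonal y * J).det := by rw [hfactor, det_smul]
    _ ≤ c ^ Fintype.card m * ∏ i, (1 + y i) := by
        gcongr
        exact det_one_add_transpose_mul_diagonal_mul_le hJ fun i =>
          sub_nonneg.mpr (le_max_right _ _)
    _ = _ := by simp only [y, add_sub_cancel]

theorem det_transpose_mul_diagonal_mul_le {f : m → n} (hf : Function.Injective f) {x : n → ℝ}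
    (hx : ∀ i, 0 < x i) {c : ℝ} (hc : 0 < c) (hle : ∀ j, c ≤ x (f j))
    (hge : ∀ i ∉ Set.range f, x i ≤ c) {J : Matrix n m ℝ} (hJ : Jᵀ * J = 1) :
    (Jᵀ * diagonal x * J).det ≤ ∏ j, x (f j) := by
  refine (det_transpose_mul_diagonal_mul_le_prod_max hJ hx hc).trans_eq ?_
  have hprod : ∏ i, max (x i / c) 1 = ∏ j, x (f j) / c := by
    refine (Fintype.prod_of_injective f hf _ _ (fun i hi => ?_) fun j => ?_).symm
    · exact max_eq_right ((div_le_one hc).mpr (hge i hi))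
    · exact (max_eq_left ((one_le_div hc).mpr (hle j))).symm
  rw [hprod, Finset.prod_div_distrib, Finset.prod_const, Finset.card_univ]
  field_simp

theorem transpose_submatrix_mul_diagonal_mul {f : m → n} (hf : Function.Injective f) (x : n → ℝ)
    {l : Type*} (J : Matrix n l ℝ) :
    (J.submatrix f id)ᵀ * diagonal (x ∘ f) * J.submatrix f id
      = Jᵀ * diagonal ((Set.range f).indicator x) * J := by
  ext a b
  rw [mul_apply, mul_apply]
  simp only [mul_diagonal, transpose_apply, submatrix_apply, id, Function.comp]
  refine Fintype.sum_of_injective f hf _ _ (fun i hi => ?_) fun j => ?_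
  · rw [Set.indicator_of_notMem hi, mul_zero, zero_mul]
  · rw [Set.indicator_of_mem (Set.mem_range_self j)]

theorem det_sq_mul_prod_le_det {f : m → n} (hf : Function.Injective f) {x : n → ℝ}
    (hx : ∀ i, 0 < x i) (J : Matrix n m ℝ) :
    (J.submatrix f id).det ^ 2 * ∏ j, x (f j) ≤ (Jᵀ * diagonal x * J).det := by
  by_cases h0 : (J.submatrix f id).det = 0
  · simpa [h0] using (posSemidef_transpose_mul_diagonal_mul (fun i => (hx i).le) J).det_nonneg
  have hinj : Function.Injective (J.submatrix f id).mulVec :=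
    mulVec_injective_iff_isUnit.mpr ((isUnit_iff_isUnit_det _).mpr (isUnit_iff_ne_zero.mpr h0))
  calc (J.submatrix f id).det ^ 2 * ∏ j, x (f j)
      = ((J.submatrix f id)ᵀ * diagonal (x ∘ f) * J.submatrix f id).det := by
        rw [det_mul, det_mul, det_transpose, det_diagonal]
        simp only [Function.comp]; ring
    _ ≤ (Jᵀ * diagonal x * J).det := by
        refine det_le_det_of_posSemidef_sub
          (posDef_transpose_mul_diagonal_mul (fun j => hx (f j)) hinj) ?_
        rw [transpose_submatrix_mul_diagonal_mul hf, ← Matrix.sub_mul, ← Matrix.mul_sub,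
          diagonal_sub]
        refine posSemidef_transpose_mul_diagonal_mul (fun i => sub_nonneg.mpr ?_) J
        exact Set.indicator_le_self' (fun _ _ => (hx _).le) i

end RealDet

section Realification

variable (𝔽 : Type*) [NormedDivisionRing 𝔽] [NormedAlgebra ℝ 𝔽] [StarRing 𝔽]
  [IsRealComplexOrQuaternion 𝔽]

/-- A real basis of `𝔽` in which left multiplication by `star a` is the transpose of left
multiplication by `a`, so that realification turns adjoints into transposes. -/
def realBasis : Module.Basis (Fin (Module.finrank ℝ 𝔽)) ℝ 𝔽 :=
  (exists_basis_leftMulMatrix_star 𝔽).choose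

variable {𝔽}

theorem leftMulMatrix_realBasis_star (a : 𝔽) :
    Algebra.leftMulMatrix (realBasis 𝔽) (star a) = (Algebra.leftMulMatrix (realBasis 𝔽) a)ᵀ :=
  (exists_basis_leftMulMatrix_star 𝔽).choose_spec a

variable {l m n : Type*}

/-- The realification of a matrix over `𝔽`: each entry is replaced by the matrix of left
multiplication by it, as `𝔽 ^ n` carries its scalars on the right. -/
def realMat (A : Matrix m n 𝔽) :
    Matrix (m × Fin (Module.finrank ℝ 𝔽)) (n × Fin (Module.finrank ℝ 𝔽)) ℝ :=
  of fun p r => Algebra.leftMulMatrix (realBasis 𝔽) (A p.1 r.1) p.2 r.2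

/-- The realification of vectors over `𝔽`. -/
def realVec : (n → 𝔽) ≃ₗ[ℝ] (n × Fin (Module.finrank ℝ 𝔽) → ℝ) :=
  (LinearEquiv.piCongrRight fun _ => (realBasis 𝔽).equivFun) ≪≫ₗ (LinearEquiv.curry ℝ ℝ n _).symm

theorem realMat_apply (A : Matrix m n 𝔽) (p r) :
    realMat A p r = Algebra.leftMulMatrix (realBasis 𝔽) (A p.1 r.1) p.2 r.2 := rfl

theorem realVec_apply (v : n → 𝔽) (p) : realVec v p = (realBasis 𝔽).repr (v p.1) p.2 := rfl

theorem realMat_mul [Fintype m] (A : Matrix l m 𝔽) (B : Matrix m n 𝔽) :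
    realMat (A * B) = realMat A * realMat B := by
  ext p r
  simp only [realMat_apply, mul_apply, map_sum, map_mul, Matrix.sum_apply, Fintype.sum_prod_type]

theorem realVec_mulVec [Fintype n] (A : Matrix m n 𝔽) (v : n → 𝔽) :
    realVec (A *ᵥ v) = realMat A *ᵥ realVec v := by
  ext p
  simp only [realVec_apply, mulVec, dotProduct, map_sum, Finsupp.coe_finsetSum, Finset.sum_apply,
    realMat_apply, Fintype.sum_prod_type]
  refine Finset.sum_congr rfl fun j _ => ?_
  rw [← Algebra.leftMulMatrix_mulVec_repr]
  rfl

theorem realMat_add (A B : Matrix m n 𝔽) : realMat (A + B) = realMat A + realMat B := by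
  ext p r
  simp only [realMat_apply, Matrix.add_apply, map_add]

theorem realMat_diagonal_algebraMap [DecidableEq n] (x : n → ℝ) :
    realMat (diagonal fun i => algebraMap ℝ 𝔽 (x i)) = diagonal fun p => x p.1 := by
  ext ⟨i, k⟩ ⟨j, l⟩
  rw [realMat_apply]
  by_cases h : i = j
  · subst h
    simp [diagonal_apply, Algebra.algebraMap_eq_smul_one, one_apply]
  · simp [h]

theorem realMat_one [DecidableEq n] : realMat (1 : Matrix n n 𝔽) = 1 := by
  simpa using realMat_diagonal_algebraMap (𝔽 := 𝔽) (n := n) 1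

theorem realMat_conjTranspose (A : Matrix m n 𝔽) : realMat Aᴴ = (realMat A)ᵀ := by
  ext p r
  rw [transpose_apply, realMat_apply, conjTranspose_apply, leftMulMatrix_realBasis_star]
  rfl

theorem realMat_submatrix {m' n' : Type*} (A : Matrix m n 𝔽) (f : m' → m) (g : n' → n) :
    realMat (A.submatrix f g) = (realMat A).submatrix (Prod.map f id) (Prod.map g id) := rfl

theorem continuous_realMat : Continuous (realMat : Matrix m n 𝔽 → _) := by
  refine continuous_matrix fun p r => ?_
  have h : Continuous (Algebra.leftMulMatrix (realBasis 𝔽)) :=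
    (Algebra.leftMulMatrix (realBasis 𝔽)).toLinearMap.continuous_of_finiteDimensional
  exact (h.comp (continuous_id.matrix_elem p.1 r.1)).matrix_elem p.2 r.2

theorem posDet_eq_det_realMat_rpow {r : ℕ} (A : Matrix (Fin r) (Fin r) 𝔽) :
    posDet A = (realMat A).det ^ (1 / (Module.finrank ℝ 𝔽 : ℝ)) := by
  rw [posDet, ← LinearMap.det_toLin', ← LinearMap.det_conj _ (realVec (𝔽 := 𝔽) (n := Fin r))]
  congr 2
  refine LinearMap.ext fun y => ?_
  obtain ⟨v, rfl⟩ := realVec.surjective y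
  rw [toLin'_apply, ← realVec_mulVec, LinearMap.comp_apply, LinearMap.comp_apply,
    LinearEquiv.coe_coe, LinearEquiv.coe_coe, LinearEquiv.symm_apply_apply]
  congr 1
  ext i
  simp [mulVec, dotProduct]

end Realification

section Reflection

variable {𝔽 : Type*} [NormedDivisionRing 𝔽] [NormedAlgebra ℝ 𝔽] [StarRing 𝔽]
  [IsRealComplexOrQuaternion 𝔽] {m : Type*} [Fintype m]

theorem exists_star_dotProduct_self_eq (v : m → 𝔽) :
    ∃ c : ℝ, 0 ≤ c ∧ star v ⬝ᵥ v = algebraMap ℝ 𝔽 c ∧ (c = 0 → v = 0) := by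
  choose c hc0 hc using fun i => exists_star_mul_self_eq (v i)
  refine ⟨∑ i, c i, Finset.sum_nonneg fun i _ => hc0 i, ?_, fun h => funext fun i => ?_⟩
  · simp only [dotProduct, Pi.star_apply, hc, map_sum]
  · have hci := (Finset.sum_eq_zero_iff_of_nonneg fun i _ => hc0 i).mp h i (Finset.mem_univ i)
    simpa [hci] using hc i

variable [DecidableEq m]

/-- The witness is the reflection in the hyperplane orthogonal to `v - w`. -/
theorem exists_unitary_mulVec_eq {v w : m → 𝔽} (hnorm : star v ⬝ᵥ v = star w ⬝ᵥ w)
    (hsymm : star v ⬝ᵥ w = star w ⬝ᵥ v) :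
    ∃ u : unitary (Matrix m m 𝔽), (u : Matrix m m 𝔽) *ᵥ v = w := by
  obtain ⟨c, -, hc, hc0⟩ := exists_star_dotProduct_self_eq (v - w)
  rcases eq_or_ne c 0 with rfl | hcz
  · exact ⟨1, by rw [OneMemClass.coe_one, one_mulVec, sub_eq_zero.mp (hc0 rfl)]⟩
  set Q : Matrix m m 𝔽 := vecMulVec (v - w) (star (v - w))
  have hQs : star Q = Q := by
    rw [star_eq_conjTranspose, conjTranspose_vecMulVec, star_star]
  have hQQ : Q * Q = c • Q := by
    rw [vecMulVec_mul_vecMulVec, hc, algebraMap_smul, vecMulVec_smul]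
  have hQv : Q *ᵥ v = (c / 2) • (v - w) := by
    have h2 : (2 : ℝ) • (star (v - w) ⬝ᵥ v) = algebraMap ℝ 𝔽 c := by
      rw [← hc, star_sub, sub_dotProduct, sub_dotProduct, dotProduct_sub, dotProduct_sub, hnorm,
        hsymm, two_smul]
      abel
    have hv : star (v - w) ⬝ᵥ v = algebraMap ℝ 𝔽 (c / 2) := by
      rw [div_eq_inv_mul, map_mul, ← h2, ← Algebra.smul_def, smul_smul,
        inv_mul_cancel₀ two_ne_zero, one_smul]
    ext i
    rw [vecMulVec_mulVec, hv, Pi.smul_apply, Pi.smul_apply, op_smul_eq_mul,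
      ← Algebra.commutes, Algebra.smul_def]
  have hRR : (1 - (2 / c) • Q) * (1 - (2 / c) • Q) = 1 := by
    have : 2 / c * (2 / c) * c = 2 / c + 2 / c := by field_simp; ring
    rw [sub_mul, mul_sub, mul_sub, one_mul, mul_one, one_mul, smul_mul_smul_comm, hQQ, smul_smul,
      this, add_smul]
    abel
  have hRs : star (1 - (2 / c) • Q) = 1 - (2 / c) • Q := by
    rw [star_sub, star_one, star_smul, hQs, star_trivial]
  refine ⟨⟨1 - (2 / c) • Q, Unitary.mem_iff.mpr ⟨by rw [hRs, hRR], by rw [hRs, hRR]⟩⟩, ?_⟩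
  have hcc : 2 / c * (c / 2) = 1 := by field_simp
  rw [sub_mulVec, one_mulVec, smul_mulVec, hQv, smul_smul, hcc, one_smul, sub_sub_cancel]

theorem exists_unitary_mulVec_eq_single {n : ℕ} (v : Fin (n + 1) → 𝔽) :
    ∃ (u : UnitaryGroup 𝔽 (n + 1)) (d : 𝔽),
      (u : Matrix (Fin (n + 1)) (Fin (n + 1)) 𝔽) *ᵥ v = Pi.single 0 d := by
  obtain ⟨c, hc0, hc, -⟩ := exists_star_dotProduct_self_eq v
  obtain ⟨d, hd, hd0⟩ :
      ∃ d : 𝔽, star d * d = algebraMap ℝ 𝔽 c ∧ star (v 0) * d = star d * v 0 := by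
    by_cases h0 : v 0 = 0
    · refine ⟨algebraMap ℝ 𝔽 √c, ?_, by simp [h0]⟩
      rw [← algebraMap_star_comm, star_trivial, ← map_mul, Real.mul_self_sqrt hc0]
    · obtain ⟨b, hb0, hb⟩ := exists_star_mul_self_eq (v 0)
      have hbz : b ≠ 0 := by
        rintro rfl
        simp [h0] at hb
      refine ⟨√(c / b) • v 0, ?_,
        by rw [star_smul, star_trivial √(c / b), mul_smul_comm, smul_mul_assoc]⟩
      rw [star_smul, star_trivial √(c / b), smul_mul_smul_comm, hb,
        Real.mul_self_sqrt (div_nonneg hc0 hb0), Algebra.smul_def, ← map_mul, div_mul_cancel₀ _ hbz]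
  obtain ⟨u, hu⟩ := exists_unitary_mulVec_eq (v := v) (w := Pi.single 0 d)
    (by simp [hc, hd]) (by simp [hd0])
  exact ⟨u, d, hu⟩

end Reflection

section BlockCons

variable {R : Type*} {m n : ℕ}

/-- The block diagonal matrix with the blocks `a` and `M`, for inductions on the size. -/
def blockCons [Zero R] (a : R) (M : Matrix (Fin n) (Fin n) R) :
    Matrix (Fin (n + 1)) (Fin (n + 1)) R :=
  of (Fin.cons (Fin.cons a 0) fun i => Fin.cons 0 (M i))

section Zero

variable [Zero R] (a : R) (M : Matrix (Fin n) (Fin n) R)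

@[simp] theorem blockCons_zero_zero : blockCons a M 0 0 = a := rfl

@[simp] theorem blockCons_zero_succ (j : Fin n) : blockCons a M 0 j.succ = 0 := rfl

@[simp] theorem blockCons_succ_zero (i : Fin n) : blockCons a M i.succ 0 = 0 := rfl

@[simp] theorem blockCons_succ_succ (i j : Fin n) : blockCons a M i.succ j.succ = M i j := rfl

theorem eq_blockCons {A : Matrix (Fin (n + 1)) (Fin (n + 1)) R} (hcol : ∀ i : Fin n, A i.succ 0 = 0)
    (hrow : ∀ j : Fin n, A 0 j.succ = 0) :
    A = blockCons (A 0 0) (A.submatrix Fin.succ Fin.succ) := by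
  ext i j
  cases i using Fin.cases <;> cases j using Fin.cases <;> simp [hcol, hrow]

end Zero

theorem blockCons_mul_apply_succ [NonAssocSemiring R] (a : R) (M : Matrix (Fin n) (Fin n) R)
    (A : Matrix (Fin (n + 1)) (Fin (m + 1)) R) (i : Fin n) (j : Fin (m + 1)) :
    (blockCons a M * A) i.succ j = (M * A.submatrix Fin.succ id) i j := by
  simp [mul_apply, Fin.sum_univ_succ]

theorem blockCons_mul [NonAssocSemiring R] (a b : R) (M N : Matrix (Fin n) (Fin n) R) :
    blockCons a M * blockCons b N = blockCons (a * b) (M * N) := by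
  ext i j
  cases i using Fin.cases <;> cases j using Fin.cases <;> simp [mul_apply, Fin.sum_univ_succ]

theorem blockCons_one [Zero R] [One R] :
    blockCons (1 : R) (1 : Matrix (Fin n) (Fin n) R) = 1 := by
  ext i j
  cases i using Fin.cases <;> cases j using Fin.cases <;>
    simp [one_apply, (Fin.succ_ne_zero _).symm]

theorem star_blockCons [NonUnitalNonAssocSemiring R] [StarRing R] (a : R)
    (M : Matrix (Fin n) (Fin n) R) : star (blockCons a M) = blockCons (star a) (star M) := by
  ext i j
  cases i using Fin.cases <;> cases j using Fin.cases <;> simp [star_apply]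

theorem blockCons_one_mem_unitary [Semiring R] [StarRing R] {M : Matrix (Fin n) (Fin n) R}
    (hM : M ∈ unitary (Matrix (Fin n) (Fin n) R)) :
    blockCons 1 M ∈ unitary (Matrix (Fin (n + 1)) (Fin (n + 1)) R) := by
  rw [Unitary.mem_iff, star_blockCons, blockCons_mul, blockCons_mul, star_one, one_mul,
    Unitary.star_mul_self_of_mem hM, Unitary.mul_star_self_of_mem hM, blockCons_one]
  exact ⟨rfl, rfl⟩

theorem realDiag_cons {𝔽 : Type*} [NormedDivisionRing 𝔽] [NormedAlgebra ℝ 𝔽] (c : ℝ)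
    (x : Fin n → ℝ) :
    (realDiag (Fin.cons c x : Fin (n + 1) → ℝ) : Matrix _ _ 𝔽) =
      blockCons (algebraMap ℝ 𝔽 c) (realDiag x) := by
  ext i j
  cases i using Fin.cases <;> cases j using Fin.cases <;>
    simp [realDiag, diagonal_apply, (Fin.succ_ne_zero _).symm]

end BlockCons

section Decompositions

variable {𝔽 : Type*} [NormedDivisionRing 𝔽] [NormedAlgebra ℝ 𝔽] [StarRing 𝔽]
  [IsRealComplexOrQuaternion 𝔽] {n : ℕ}

theorem exists_unitary_mul_blockTriangular (s : Matrix (Fin n) (Fin n) 𝔽) :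
    ∃ (u : UnitaryGroup 𝔽 n) (b : Matrix (Fin n) (Fin n) 𝔽),
      s = (u : Matrix (Fin n) (Fin n) 𝔽) * b ∧ b.BlockTriangular id := by
  suffices h : ∃ u : UnitaryGroup 𝔽 n,
      ((u : Matrix (Fin n) (Fin n) 𝔽) * s).BlockTriangular id by
    obtain ⟨u, hu⟩ := h
    exact ⟨star u, _, by rw [Unitary.coe_star, ← mul_assoc, Unitary.coe_star_mul_self, one_mul], hu⟩
  induction n with
  | zero => exact ⟨1, fun i => i.elim0⟩
  | succ n ih =>
    obtain ⟨u, d, hu⟩ := exists_unitary_mulVec_eq_single fun i => s i 0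
    set U : Matrix (Fin (n + 1)) (Fin (n + 1)) 𝔽 := ↑u
    have hcol (i : Fin n) : (U * s) i.succ 0 = 0 := by
      simpa [mulVec, dotProduct, mul_apply] using congrFun hu i.succ
    obtain ⟨v, hv⟩ := ih ((U * s).submatrix Fin.succ Fin.succ)
    refine ⟨⟨_, blockCons_one_mem_unitary v.2⟩ * u, fun i j hij => ?_⟩
    cases i using Fin.cases with
    | zero => exact absurd hij (Fin.not_lt_zero j)
    | succ i =>
      rw [Submonoid.coe_mul, mul_assoc, blockCons_mul_apply_succ]
      cases j using Fin.cases with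
      | zero =>
        rw [mul_apply]
        exact Finset.sum_eq_zero fun k _ => by rw [submatrix_apply, id, hcol, mul_zero]
      | succ j => exact hv (Fin.succ_lt_succ_iff.mp hij)

theorem exists_mulVec_eq_smul (A : Matrix (Fin (n + 1)) (Fin (n + 1)) 𝔽) (hA : star A = A) :
    ∃ (v : Fin (n + 1) → 𝔽) (c : ℝ), v ≠ 0 ∧ A *ᵥ v = c • v := by
  have hH : (realMat A).IsHermitian := by
    rw [IsHermitian, conjTranspose_eq_transpose_of_trivial, ← realMat_conjTranspose,
      ← star_eq_conjTranspose, hA]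
  let p : Fin (n + 1) × Fin (Module.finrank ℝ 𝔽) := (0, ⟨0, Module.finrank_pos⟩)
  refine ⟨realVec.symm (hH.eigenvectorBasis p), hH.eigenvalues p, ?_, realVec.injective ?_⟩
  · rw [Ne, LinearEquiv.map_eq_zero_iff, WithLp.ofLp_eq_zero]
    exact hH.eigenvectorBasis.orthonormal.ne_zero p
  · rw [realVec_mulVec, map_smul, LinearEquiv.apply_symm_apply, hH.mulVec_eigenvectorBasis]

theorem exists_unitary_conj_eq_blockCons (A : Matrix (Fin (n + 1)) (Fin (n + 1)) 𝔽)
    (hA : star A = A) : ∃ (u : UnitaryGroup 𝔽 (n + 1)) (c : ℝ) (M : Matrix (Fin n) (Fin n) 𝔽),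
      star M = M ∧ (u : Matrix (Fin (n + 1)) (Fin (n + 1)) 𝔽) * A *
        star (u : Matrix (Fin (n + 1)) (Fin (n + 1)) 𝔽) = blockCons (algebraMap ℝ 𝔽 c) M := by
  obtain ⟨v, c, hv, hAv⟩ := exists_mulVec_eq_smul A hA
  obtain ⟨u, d, hu⟩ := exists_unitary_mulVec_eq_single v
  set U : Matrix (Fin (n + 1)) (Fin (n + 1)) 𝔽 := ↑u
  have hUU : star U * U = 1 := Unitary.coe_star_mul_self u
  have hd0 : d ≠ 0 := by
    rintro rfl
    apply hv
    rw [← one_mulVec v, ← hUU, ← mulVec_mulVec, hu, Pi.single_zero, mulVec_zero]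
  have hBs : star (U * A * star U) = U * A * star U := by
    rw [star_mul, star_mul, star_star, hA, mul_assoc]
  have hBd : (U * A * star U) *ᵥ Pi.single 0 d = c • Pi.single 0 d := by
    rw [← hu, mulVec_mulVec, mul_assoc, hUU, mul_one, ← mulVec_mulVec, hAv, mulVec_smul]
  set B := U * A * star U
  have hB0 : B 0 0 = algebraMap ℝ 𝔽 c := by
    refine mul_right_cancel₀ hd0 ?_
    simpa [Algebra.smul_def] using congrFun hBd 0
  have hcol (i : Fin n) : B i.succ 0 = 0 := by
    simpa [hd0] using congrFun hBd i.succ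
  have hrow (j : Fin n) : B 0 j.succ = 0 := by
    rw [← hBs, star_apply, hcol, star_zero]
  refine ⟨u, c, B.submatrix Fin.succ Fin.succ, ?_, hB0 ▸ eq_blockCons hcol hrow⟩
  rw [star_eq_conjTranspose, conjTranspose_submatrix, ← star_eq_conjTranspose, hBs]

theorem exists_unitary_diagonalization (A : Matrix (Fin n) (Fin n) 𝔽) (hA : star A = A) :
    ∃ (u : UnitaryGroup 𝔽 n) (x : Fin n → ℝ), A = (u : Matrix (Fin n) (Fin n) 𝔽) *
      realDiag x * star (u : Matrix (Fin n) (Fin n) 𝔽) := by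
  suffices h : ∃ (u : UnitaryGroup 𝔽 n) (x : Fin n → ℝ), (u : Matrix (Fin n) (Fin n) 𝔽) *
      A * star (u : Matrix (Fin n) (Fin n) 𝔽) = realDiag x by
    obtain ⟨u, x, hu⟩ := h
    refine ⟨star u, x, ?_⟩
    rw [← hu, Unitary.coe_star, star_star]
    simp only [← mul_assoc, Unitary.coe_star_mul_self, one_mul]
    rw [mul_assoc, Unitary.coe_star_mul_self, mul_one]
  induction n with
  | zero => exact ⟨1, 0, by ext i; exact i.elim0⟩
  | succ n ih =>
    obtain ⟨u, c, M, hM, hu⟩ := exists_unitary_conj_eq_blockCons A hA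
    obtain ⟨w, x, hw⟩ := ih M hM
    refine ⟨⟨_, blockCons_one_mem_unitary w.2⟩ * u, Fin.cons c x, ?_⟩
    calc
      _ = blockCons 1 (w : Matrix (Fin n) (Fin n) 𝔽) * (u * A * star u) *
          star (blockCons 1 (w : Matrix (Fin n) (Fin n) 𝔽)) := by
        simp only [Submonoid.coe_mul, star_mul, Unitary.coe_star, mul_assoc]
      _ = realDiag (Fin.cons c x) := by
        rw [Unitary.coe_star, hu, star_blockCons, blockCons_mul, blockCons_mul, hw, star_one,
          one_mul, mul_one, realDiag_cons]

theorem submatrix_mem_unitary {l R : Type*} [Fintype l] [DecidableEq l] [Semiring R] [StarRing R]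
    {u : Matrix l l R} (hu : u ∈ unitary (Matrix l l R)) (σ : Equiv.Perm l) :
    u.submatrix id σ ∈ unitary (Matrix l l R) := by
  rw [Unitary.mem_iff, star_eq_conjTranspose, conjTranspose_submatrix, submatrix_mul_equiv,
    ← submatrix_mul _ _ σ id σ Function.bijective_id, ← star_eq_conjTranspose,
    Unitary.star_mul_self_of_mem hu, Unitary.mul_star_self_of_mem hu, submatrix_one_equiv]
  exact ⟨rfl, submatrix_id_id _⟩

theorem exists_isOrderedSpectrum (A : Matrix (Fin n) (Fin n) 𝔽) (hA : star A = A) :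
    ∃ x, IsOrderedSpectrum A x := by
  obtain ⟨u, x, hu⟩ := exists_unitary_diagonalization A hA
  let σ : Equiv.Perm (Fin n) := Tuple.sort fun i => -x i
  refine ⟨x ∘ σ, fun i j hij => neg_le_neg_iff.mp (Tuple.monotone_sort (fun i => -x i) hij),
    ⟨_, submatrix_mem_unitary u.2 σ⟩, ?_⟩
  have hσ : (realDiag (x ∘ σ) : Matrix _ _ 𝔽) = (realDiag x).submatrix σ σ :=
    (submatrix_diagonal_equiv (fun i => algebraMap ℝ 𝔽 (x i)) σ).symm
  rw [hu, hσ, star_eq_conjTranspose, star_eq_conjTranspose, conjTranspose_submatrix,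
    submatrix_mul_equiv, submatrix_mul_equiv, submatrix_id_id]

end Decompositions

section Minors

variable {𝔽 : Type*} [NormedDivisionRing 𝔽] [NormedAlgebra ℝ 𝔽] [StarRing 𝔽]
  [IsRealComplexOrQuaternion 𝔽] {q : ℕ}

/-- The inclusion of the index set of the realified leading block of size `r + 1`. -/
def leadingIndex (r : Fin q) {κ : Type*} : Fin (r + 1) × κ → Fin q × κ :=
  Prod.map (Fin.castLE r.isLt) id

theorem leadingIndex_injective (r : Fin q) {κ : Type*} :
    Function.Injective (leadingIndex r : Fin (r + 1) × κ → Fin q × κ) :=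
  (Fin.castLE_injective _).prodMap Function.injective_id

theorem leadingIndex_fst_le {r : Fin q} {κ : Type*} (j : Fin (r + 1) × κ) :
    (leadingIndex r j).1 ≤ r :=
  Fin.le_def.mpr (Nat.lt_succ_iff.mp j.1.isLt)

theorem le_fst_of_notMem_range_leadingIndex {r : Fin q} {κ : Type*} {p : Fin q × κ}
    (hp : p ∉ Set.range (leadingIndex r)) : r ≤ p.1 := by
  by_contra! hlt
  exact hp ⟨(⟨p.1, Nat.lt_succ_of_lt hlt⟩, p.2), rfl⟩

/-- The realification of the first `r + 1` columns of `g`. -/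
def realCols (g : Matrix (Fin q) (Fin q) 𝔽) (r : Fin q) :
    Matrix (Fin q × Fin (Module.finrank ℝ 𝔽)) (Fin (r + 1) × Fin (Module.finrank ℝ 𝔽)) ℝ :=
  realMat (g.submatrix id (Fin.castLE r.isLt))

/-- The determinant of the realification of the leading block of size `r + 1` of `g`. -/
def realMinor (g : Matrix (Fin q) (Fin q) 𝔽) (r : Fin q) : ℝ :=
  ((realCols g r).submatrix (leadingIndex r) id).det

theorem minor_eq_realMinor_rpow (A : Matrix (Fin q) (Fin q) 𝔽) (r : Fin q) :
    minor A r = realMinor A r ^ (1 / (Module.finrank ℝ 𝔽 : ℝ)) :=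
  posDet_eq_det_realMat_rpow _

theorem realMinor_one (r : Fin q) : realMinor (1 : Matrix (Fin q) (Fin q) 𝔽) r = 1 := by
  change (realMat (submatrix 1 (Fin.castLE r.isLt) (Fin.castLE r.isLt))).det = 1
  rw [submatrix_one _ (Fin.castLE_injective _), realMat_one, det_one]

theorem transpose_realCols_mul_realCols (g h : Matrix (Fin q) (Fin q) 𝔽) (r : Fin q) :
    (realCols g r)ᵀ * realCols h r =
      (realMat (star g * h)).submatrix (leadingIndex r) (leadingIndex r) := by
  rw [realCols, realCols, ← realMat_conjTranspose, ← realMat_mul, conjTranspose_submatrix,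
    ← submatrix_mul _ _ _ _ _ Function.bijective_id, star_eq_conjTranspose]
  rfl

theorem realMinor_star_mul_self (g : Matrix (Fin q) (Fin q) 𝔽) (r : Fin q) :
    realMinor (star g * g) r = ((realCols g r)ᵀ * realCols g r).det := by
  rw [transpose_realCols_mul_realCols]
  rfl

theorem realMinor_star_mul_self_nonneg (g : Matrix (Fin q) (Fin q) 𝔽) (r : Fin q) :
    0 ≤ realMinor (star g * g) r := by
  rw [realMinor_star_mul_self]
  simpa using (posSemidef_conjTranspose_mul_self (realCols g r)).det_nonneg

theorem posDef_realMat_star_mul_self {m : Type*} [Fintype m] [DecidableEq m] {g : Matrix m m 𝔽}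
    (hg : IsUnit g) : (realMat (star g * g)).PosDef := by
  obtain ⟨h, hh⟩ := hg.exists_left_inv
  have hreal : IsUnit (realMat g) :=
    IsUnit.of_mul_eq_one_right (realMat h) (by rw [← realMat_mul, hh, realMat_one])
  rw [realMat_mul, star_eq_conjTranspose, realMat_conjTranspose]
  simpa using PosDef.conjTranspose_mul_self (realMat g) (mulVec_injective_of_isUnit hreal)

theorem realMinor_star_mul_self_pos {g : Matrix (Fin q) (Fin q) 𝔽} (hg : IsUnit g) (r : Fin q) :
    0 < realMinor (star g * g) r :=
  ((posDef_realMat_star_mul_self hg).submatrix (leadingIndex_injective r)).det_pos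

theorem minor_star_mul_self_pos {g : Matrix (Fin q) (Fin q) 𝔽} (hg : IsUnit g) (r : Fin q) :
    0 < minor (star g * g) r := by
  rw [minor_eq_realMinor_rpow]
  exact Real.rpow_pos_of_pos (realMinor_star_mul_self_pos hg r) _

theorem transpose_realCols_mul_realCols_unitary (v : UnitaryGroup 𝔽 q) (r : Fin q) :
    (realCols (v : Matrix (Fin q) (Fin q) 𝔽) r)ᵀ * realCols (v : Matrix (Fin q) (Fin q) 𝔽) r =
      1 := by
  rw [transpose_realCols_mul_realCols, Unitary.coe_star_mul_self, realMat_one,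
    submatrix_one _ (leadingIndex_injective r)]

theorem realCols_realDiag_mul (x : Fin q → ℝ) (v : Matrix (Fin q) (Fin q) 𝔽) (r : Fin q) :
    realCols (realDiag x * v) r =
      diagonal (fun p : Fin q × Fin (Module.finrank ℝ 𝔽) => x p.1) * realCols v r := by
  rw [realCols, realCols, ← realMat_diagonal_algebraMap (𝔽 := 𝔽), ← realMat_mul]
  rfl

theorem realCols_mul_of_blockTriangular (x : Matrix (Fin q) (Fin q) 𝔽)
    {b : Matrix (Fin q) (Fin q) 𝔽} (hb : b.BlockTriangular id) (r : Fin q) :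
    realCols (x * b) r = realCols x r * (realCols b r).submatrix (leadingIndex r) id := by
  have h : (x * b).submatrix id (Fin.castLE r.isLt) =
      x.submatrix id (Fin.castLE r.isLt) *
        b.submatrix (Fin.castLE r.isLt : Fin (r + 1) → Fin q) (Fin.castLE r.isLt) := by
    ext i j
    rw [submatrix_apply, mul_apply, mul_apply]
    refine (Fintype.sum_of_injective _ (Fin.castLE_injective r.isLt) _ _ (fun k hk => ?_)
      fun _ => rfl).symm
    have hjk : Fin.castLE r.isLt j < k := by
      by_contra! hkj
      exact hk ⟨⟨k, (Fin.le_def.mp hkj).trans_lt j.isLt⟩, rfl⟩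
    rw [show b k (Fin.castLE r.isLt j) = 0 from hb hjk, mul_zero]
  rw [realCols, h, realMat_mul]
  rfl

theorem realMinor_star_mul_self_mul_of_blockTriangular (x : Matrix (Fin q) (Fin q) 𝔽)
    {b : Matrix (Fin q) (Fin q) 𝔽} (hb : b.BlockTriangular id) (r : Fin q) :
    realMinor (star (x * b) * (x * b)) r = realMinor (star x * x) r * realMinor b r ^ 2 := by
  rw [realMinor_star_mul_self, realMinor_star_mul_self, realCols_mul_of_blockTriangular x hb,
    transpose_mul, Matrix.mul_assoc, ← Matrix.mul_assoc (realCols x r)ᵀ, det_mul, det_mul,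
    det_transpose, ← realMinor]
  ring

end Minors

section LogMinor

variable {𝔽 : Type*} [NormedDivisionRing 𝔽] [NormedAlgebra ℝ 𝔽] [StarRing 𝔽] {q : ℕ}

/-- Half the logarithm of the principal minor of order `r + 1` of `g* g`. For `g ∈ GL(q, 𝔽)` this
is the sum of the first `r + 1` coordinates of the abelian part of `g` in the Iwasawa
decomposition. -/
def logMinor (g : Matrix (Fin q) (Fin q) 𝔽) (r : Fin q) : ℝ :=
  1 / 2 * Real.log (minor (star g * g) r)

theorem logMinor_unitary_mul (u : UnitaryGroup 𝔽 q) (g : Matrix (Fin q) (Fin q) 𝔽) :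
    logMinor ((u : Matrix (Fin q) (Fin q) 𝔽) * g) = logMinor g := by
  ext r
  rw [logMinor, logMinor, star_mul, mul_assoc, ← mul_assoc (star (u : Matrix (Fin q) (Fin q) 𝔽)),
    Unitary.coe_star_mul_self, one_mul]

variable [IsRealComplexOrQuaternion 𝔽]

theorem logMinor_eq_log_realMinor (g : Matrix (Fin q) (Fin q) 𝔽) (r : Fin q) :
    logMinor g r = 1 / (2 * Module.finrank ℝ 𝔽) * Real.log (realMinor (star g * g) r) := by
  have hd : (0 : ℝ) < Module.finrank ℝ 𝔽 := Nat.cast_pos.mpr Module.finrank_pos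
  rw [logMinor, minor_eq_realMinor_rpow]
  rcases (realMinor_star_mul_self_nonneg g r).eq_or_lt with h | h
  · rw [← h, Real.zero_rpow (by positivity), Real.log_zero, mul_zero, mul_zero]
  · rw [Real.log_rpow h]
    field_simp

theorem logMinor_unitary (u : UnitaryGroup 𝔽 q) :
    logMinor (u : Matrix (Fin q) (Fin q) 𝔽) = 0 := by
  ext r
  rw [logMinor_eq_log_realMinor, Unitary.coe_star_mul_self, realMinor_one, Real.log_one, mul_zero,
    Pi.zero_apply]

/-- With the QR decomposition `s = u b`, the triangular factor `b` contributes the same factor to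
the minors of `(x s)* (x s)` for all `x`. -/
theorem exists_unitary_logMinor_mul {s : Matrix (Fin q) (Fin q) 𝔽} (hs : IsUnit s) :
    ∃ u : UnitaryGroup 𝔽 q, ∀ x : Matrix (Fin q) (Fin q) 𝔽, IsUnit x →
      logMinor (x * s) = logMinor (x * (u : Matrix (Fin q) (Fin q) 𝔽)) + logMinor s := by
  obtain ⟨u, b, rfl, hb⟩ := exists_unitary_mul_blockTriangular s
  refine ⟨u, fun x hx => funext fun r => ?_⟩
  have hu : IsUnit (u : Matrix (Fin q) (Fin q) 𝔽) := (Unitary.toUnits u).isUnit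
  have hub := realMinor_star_mul_self_mul_of_blockTriangular (u : Matrix (Fin q) (Fin q) 𝔽) hb r
  rw [Unitary.coe_star_mul_self, realMinor_one, one_mul] at hub
  rw [← mul_assoc, Pi.add_apply, logMinor_eq_log_realMinor, logMinor_eq_log_realMinor,
    logMinor_eq_log_realMinor, realMinor_star_mul_self_mul_of_blockTriangular _ hb, hub,
    Real.log_mul (realMinor_star_mul_self_pos (hx.mul hu) r).ne'
      (hub ▸ (realMinor_star_mul_self_pos hs r).ne'), mul_add]

end LogMinor

section ExpDiagonal

variable {𝔽 : Type*} [NormedDivisionRing 𝔽] [NormedAlgebra ℝ 𝔽] {q : ℕ}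

variable (𝔽) in
/-- The diagonal matrix `e^t = diag(e^{t_1}, …, e^{t_q})`. -/
def expDiag (t : Fin q → ℝ) : Matrix (Fin q) (Fin q) 𝔽 := realDiag fun i => Real.exp (t i)

theorem expDiag_mul_expDiag (s t : Fin q → ℝ) :
    expDiag 𝔽 s * expDiag 𝔽 t = expDiag 𝔽 (s + t) := by
  simp only [expDiag, realDiag, diagonal_mul_diagonal, ← map_mul, ← Real.exp_add, Pi.add_apply]

theorem expDiag_zero : expDiag 𝔽 (0 : Fin q → ℝ) = 1 := by
  simp [expDiag, realDiag]

theorem expDiag_neg_mul_expDiag (t : Fin q → ℝ) : expDiag 𝔽 (-t) * expDiag 𝔽 t = 1 := by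
  rw [expDiag_mul_expDiag, neg_add_cancel, expDiag_zero]

theorem expDiag_mul_expDiag_neg (t : Fin q → ℝ) : expDiag 𝔽 t * expDiag 𝔽 (-t) = 1 := by
  rw [expDiag_mul_expDiag, add_neg_cancel, expDiag_zero]

theorem isUnit_expDiag (t : Fin q → ℝ) : IsUnit (expDiag 𝔽 t) :=
  .of_mul_eq_one _ (expDiag_mul_expDiag_neg t)

variable [StarRing 𝔽]

theorem isUnit_expDiag_mul (t : Fin q → ℝ) (v : UnitaryGroup 𝔽 q) :
    IsUnit (expDiag 𝔽 t * (v : Matrix (Fin q) (Fin q) 𝔽)) :=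
  (isUnit_expDiag t).mul (Unitary.toUnits v).isUnit

variable [IsRealComplexOrQuaternion 𝔽]

theorem realMinor_star_expDiag_mul_self (t : Fin q → ℝ) (v : Matrix (Fin q) (Fin q) 𝔽)
    (r : Fin q) :
    realMinor (star (expDiag 𝔽 t * v) * (expDiag 𝔽 t * v)) r =
      ((realCols v r)ᵀ *
        diagonal (fun p : Fin q × Fin (Module.finrank ℝ 𝔽) => Real.exp (2 * t p.1)) *
        realCols v r).det := by
  rw [realMinor_star_mul_self, expDiag, realCols_realDiag_mul, transpose_mul, diagonal_transpose,
    Matrix.mul_assoc, ← Matrix.mul_assoc (diagonal _) (diagonal _), diagonal_mul_diagonal,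
    ← Matrix.mul_assoc]
  simp only [← Real.exp_add, ← two_mul]

/-- The sum of the first `r + 1` entries of `t`. -/
def partialSum (t : Fin q → ℝ) (r : Fin q) : ℝ := ∑ i : Fin (r + 1), t (Fin.castLE r.isLt i)

theorem prod_exp_two_mul_leadingIndex (t : Fin q → ℝ) (r : Fin q) (d : ℕ) :
    ∏ p : Fin (r + 1) × Fin d, Real.exp (2 * t (leadingIndex r p).1) =
      Real.exp (2 * d * partialSum t r) := by
  rw [← Real.exp_sum, Fintype.sum_prod_type]
  simp only [leadingIndex, Prod.map_fst, Finset.sum_const, Finset.card_univ, Fintype.card_fin,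
    nsmul_eq_mul, partialSum, Finset.mul_sum]
  exact congrArg _ (Finset.sum_congr rfl fun i _ => by ring)

theorem logMinor_expDiag_mul_le {t : Fin q → ℝ} (ht : Antitone t) (v : UnitaryGroup 𝔽 q)
    (r : Fin q) :
    logMinor (expDiag 𝔽 t * (v : Matrix (Fin q) (Fin q) 𝔽)) r ≤ partialSum t r := by
  have hd : (0 : ℝ) < Module.finrank ℝ 𝔽 := Nat.cast_pos.mpr Module.finrank_pos
  have hle := det_transpose_mul_diagonal_mul_le (leadingIndex_injective r)
    (x := fun p => Real.exp (2 * t p.1)) (fun _ => Real.exp_pos _) (Real.exp_pos (2 * t r))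
    (fun j => by gcongr; exact ht (leadingIndex_fst_le j))
    (fun p hp => by gcongr; exact ht (le_fst_of_notMem_range_leadingIndex hp))
    (transpose_realCols_mul_realCols_unitary v r)
  rw [← realMinor_star_expDiag_mul_self, prod_exp_two_mul_leadingIndex] at hle
  have hlog := Real.log_le_log (realMinor_star_mul_self_pos (isUnit_expDiag_mul t v) r) hle
  rw [Real.log_exp] at hlog
  rw [logMinor_eq_log_realMinor]
  calc _ ≤ 1 / (2 * Module.finrank ℝ 𝔽 : ℝ) * (2 * Module.finrank ℝ 𝔽 * partialSum t r) := by gcongr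
    _ = _ := by field_simp

theorem realMinor_sq_mul_exp_le (t : Fin q → ℝ) (v : Matrix (Fin q) (Fin q) 𝔽) (r : Fin q) :
    realMinor v r ^ 2 * Real.exp (2 * Module.finrank ℝ 𝔽 * partialSum t r) ≤
      realMinor (star (expDiag 𝔽 t * v) * (expDiag 𝔽 t * v)) r := by
  rw [realMinor_star_expDiag_mul_self, ← prod_exp_two_mul_leadingIndex]
  exact det_sq_mul_prod_le_det (leadingIndex_injective r) (x := fun p => Real.exp (2 * t p.1))
    (fun _ => Real.exp_pos _) (realCols v r)

theorem le_logMinor_expDiag_mul (t : Fin q → ℝ) (v : Matrix (Fin q) (Fin q) 𝔽) {r : Fin q}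
    (h0 : realMinor v r ≠ 0) :
    partialSum t r + 1 / Module.finrank ℝ 𝔽 * Real.log |realMinor v r| ≤
      logMinor (expDiag 𝔽 t * v) r := by
  have hd : (0 : ℝ) < Module.finrank ℝ 𝔽 := Nat.cast_pos.mpr Module.finrank_pos
  have hlog := Real.log_le_log (by positivity) (realMinor_sq_mul_exp_le t v r)
  rw [Real.log_mul (by positivity) (by positivity), Real.log_exp, Real.log_pow,
    ← Real.log_abs] at hlog
  rw [logMinor_eq_log_realMinor]
  calc _ = 1 / (2 * Module.finrank ℝ 𝔽 : ℝ) *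
        (((2 : ℕ) : ℝ) * Real.log |realMinor v r| +
          2 * Module.finrank ℝ 𝔽 * partialSum t r) := by push_cast; field_simp; ring
    _ ≤ _ := by gcongr

theorem abs_realMinor_unitary_le_one (v : UnitaryGroup 𝔽 q) (r : Fin q) :
    |realMinor (v : Matrix (Fin q) (Fin q) 𝔽) r| ≤ 1 := by
  have h := realMinor_sq_mul_exp_le 0 (v : Matrix (Fin q) (Fin q) 𝔽) r
  rw [expDiag_zero, one_mul, Unitary.coe_star_mul_self, realMinor_one] at h
  simpa [partialSum] using h

theorem logMinor_expDiag {t : Fin q → ℝ} (ht : Antitone t) :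
    logMinor (expDiag 𝔽 t) = partialSum t := by
  ext r
  refine le_antisymm ?_ ?_
  · simpa using logMinor_expDiag_mul_le ht (1 : UnitaryGroup 𝔽 q) r
  · simpa [realMinor_one] using le_logMinor_expDiag_mul t (1 : Matrix (Fin q) (Fin q) 𝔽) (r := r)

theorem logMinor_expDiag_mul_mono {s t : Fin q → ℝ} (hst : s ≤ t) (v : UnitaryGroup 𝔽 q) :
    logMinor (expDiag 𝔽 s * (v : Matrix (Fin q) (Fin q) 𝔽)) ≤
      logMinor (expDiag 𝔽 t * (v : Matrix (Fin q) (Fin q) 𝔽)) := by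
  intro r
  have hpos := realMinor_star_mul_self_pos (isUnit_expDiag_mul s v) r
  rw [logMinor_eq_log_realMinor, logMinor_eq_log_realMinor]
  rw [realMinor_star_expDiag_mul_self] at hpos ⊢
  rw [realMinor_star_expDiag_mul_self]
  gcongr
  refine det_transpose_mul_diagonal_mul_mono (fun _ => Real.exp_pos _) (fun p => ?_)
    (mulVec_injective_of_transpose_mul_self (transpose_realCols_mul_realCols_unitary v r))
  exact Real.exp_le_exp.mpr (mul_le_mul_of_nonneg_left (hst p.1) zero_le_two)

theorem logMinor_expDiag_const_mul (c : ℝ) (v : UnitaryGroup 𝔽 q) (r : Fin q) :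
    logMinor (expDiag 𝔽 (fun _ => c) * (v : Matrix (Fin q) (Fin q) 𝔽)) r = (r + 1) * c := by
  have hd : (0 : ℝ) < Module.finrank ℝ 𝔽 := Nat.cast_pos.mpr Module.finrank_pos
  rw [logMinor_eq_log_realMinor, realMinor_star_expDiag_mul_self, ← smul_one_eq_diagonal,
    Matrix.mul_smul, Matrix.smul_mul, Matrix.mul_one, transpose_realCols_mul_realCols_unitary,
    det_smul, det_one, mul_one, Real.log_pow, Real.log_exp, Fintype.card_prod, Fintype.card_fin,
    Fintype.card_fin]
  push_cast
  field_simp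

theorem abs_logMinor_expDiag_mul_le (t : Fin q → ℝ) (v : UnitaryGroup 𝔽 q) (r : Fin q) :
    |logMinor (expDiag 𝔽 t * (v : Matrix (Fin q) (Fin q) 𝔽)) r| ≤ q * ∑ i, |t i| := by
  set c := ∑ i, |t i|
  have hc (i : Fin q) : |t i| ≤ c :=
    Finset.single_le_sum (f := fun i => |t i|) (fun i _ => abs_nonneg _) (Finset.mem_univ i)
  have : 0 ≤ c := Finset.sum_nonneg fun i _ => abs_nonneg _
  have hr : ((r : ℕ) + 1 : ℝ) ≤ q := by exact_mod_cast r.isLt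
  have hlow := logMinor_expDiag_mul_mono (fun i => (abs_le.mp (hc i)).1) v r
  have hupp := logMinor_expDiag_mul_mono (fun i => (abs_le.mp (hc i)).2) v r
  rw [logMinor_expDiag_const_mul] at hlow hupp
  calc _ ≤ (r + 1) * c := abs_le.mpr ⟨by linarith, hupp⟩
    _ ≤ q * c := by gcongr

end ExpDiagonal

section SingularValues

variable {𝔽 : Type*} [NormedDivisionRing 𝔽] [NormedAlgebra ℝ 𝔽] [StarRing 𝔽]
  [IsRealComplexOrQuaternion 𝔽] {q : ℕ}

theorem isOrderedSpectrum_orderedSpectrum {A : Matrix (Fin q) (Fin q) 𝔽} (hA : star A = A) :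
    IsOrderedSpectrum A (orderedSpectrum A) := by
  have hex := exists_isOrderedSpectrum A hA
  rw [orderedSpectrum, dif_pos hex]
  exact hex.choose_spec

theorem exists_star_mul_self_eq_realDiag_orderedSpectrum (g : Matrix (Fin q) (Fin q) 𝔽) :
    ∃ u : UnitaryGroup 𝔽 q, star (g * (u : Matrix (Fin q) (Fin q) 𝔽)) *
        (g * (u : Matrix (Fin q) (Fin q) 𝔽)) = realDiag (orderedSpectrum (star g * g)) := by
  obtain ⟨-, u, hu⟩ :=
    isOrderedSpectrum_orderedSpectrum (A := star g * g) (by rw [star_mul, star_star])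
  refine ⟨u, ?_⟩
  set U : Matrix (Fin q) (Fin q) 𝔽 := ↑u
  have hUU : star U * U = 1 := Unitary.coe_star_mul_self u
  calc star (g * U) * (g * U) = star U * (star g * g) * U := by
        rw [star_mul]; simp only [mul_assoc]
    _ = (star U * U) * realDiag (orderedSpectrum (star g * g)) * (star U * U) := by
        conv_lhs => rw [hu]
        simp only [mul_assoc]
    _ = _ := by rw [hUU, one_mul, mul_one]

theorem orderedSpectrum_star_mul_self_pos (g : GL (Fin q) 𝔽) (i : Fin q) :
    0 < orderedSpectrum
      (star (g : Matrix (Fin q) (Fin q) 𝔽) * (g : Matrix (Fin q) (Fin q) 𝔽)) i := by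
  obtain ⟨u, hu⟩ := exists_star_mul_self_eq_realDiag_orderedSpectrum (g : Matrix (Fin q) (Fin q) 𝔽)
  have h := posDef_realMat_star_mul_self (g.isUnit.mul (Unitary.toUnits u).isUnit)
  rw [Unitary.val_toUnits_apply, hu, realDiag, realMat_diagonal_algebraMap] at h
  simpa using h.diag_pos (i := (i, ⟨0, Module.finrank_pos⟩))

theorem exp_logSingularSpectrum (g : GL (Fin q) 𝔽) (i : Fin q) :
    Real.exp (logSingularSpectrum g i) =
      √(orderedSpectrum
        (star (g : Matrix (Fin q) (Fin q) 𝔽) * (g : Matrix (Fin q) (Fin q) 𝔽)) i) :=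
  Real.exp_log (Real.sqrt_pos.mpr (orderedSpectrum_star_mul_self_pos g i))

theorem antitone_logSingularSpectrum (g : GL (Fin q) 𝔽) : Antitone (logSingularSpectrum g) := by
  intro i j hij
  refine Real.log_le_log (Real.sqrt_pos.mpr (orderedSpectrum_star_mul_self_pos g j))
    (Real.sqrt_le_sqrt ?_)
  exact (isOrderedSpectrum_orderedSpectrum (by rw [star_mul, star_star])).1 hij

theorem realDiag_orderedSpectrum_star_mul_self (g : GL (Fin q) 𝔽) :
    realDiag (orderedSpectrum
        (star (g : Matrix (Fin q) (Fin q) 𝔽) * (g : Matrix (Fin q) (Fin q) 𝔽))) =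
      expDiag 𝔽 (logSingularSpectrum g) * expDiag 𝔽 (logSingularSpectrum g) := by
  simp only [expDiag, realDiag, diagonal_mul_diagonal, ← map_mul, exp_logSingularSpectrum,
    Real.mul_self_sqrt (orderedSpectrum_star_mul_self_pos g _).le]

theorem exists_eq_unitary_mul_expDiag_mul_unitary (g : GL (Fin q) 𝔽) :
    ∃ k l : UnitaryGroup 𝔽 q, (g : Matrix (Fin q) (Fin q) 𝔽) =
      (k : Matrix (Fin q) (Fin q) 𝔽) * expDiag 𝔽 (logSingularSpectrum g) * l := by
  obtain ⟨u, hu⟩ := exists_star_mul_self_eq_realDiag_orderedSpectrum (g : Matrix (Fin q) (Fin q) 𝔽)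
  set t := logSingularSpectrum g
  rw [realDiag_orderedSpectrum_star_mul_self] at hu
  set k := (g : Matrix (Fin q) (Fin q) 𝔽) * u * expDiag 𝔽 (-t)
  have hk : star k * k = 1 := by
    calc star k * k = expDiag 𝔽 (-t) * (expDiag 𝔽 t * expDiag 𝔽 t) * expDiag 𝔽 (-t) := by
          rw [star_mul, expDiag, star_realDiag, ← expDiag, ← hu]
          simp only [k, mul_assoc]
      _ = 1 := by
          rw [← mul_assoc, expDiag_neg_mul_expDiag, one_mul, expDiag_mul_expDiag_neg]
  refine ⟨⟨k, Unitary.mem_iff.mpr ⟨hk, mul_eq_one_comm.mp hk⟩⟩, star u, ?_⟩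
  change _ = k * expDiag 𝔽 t * star (u : Matrix (Fin q) (Fin q) 𝔽)
  rw [mul_assoc _ _ (expDiag 𝔽 t), expDiag_neg_mul_expDiag, mul_one, mul_assoc,
    Unitary.mul_star_self_of_mem u.2, mul_one]

end SingularValues

section SingularIntegrals

theorem lintegral_inv_abs_rpow_lt_top {a : ℝ} (ha : a < 1) :
    ∫⁻ y in Set.Icc (-1 : ℝ) 1, (ENNReal.ofReal (|y| ^ a))⁻¹ < ∞ := by
  have hint : IntervalIntegrable (fun y : ℝ => |y| ^ (-a)) volume (-1) 1 := by
    refine intervalIntegrable_of_even (fun y => by rw [abs_neg]) fun x hx => ?_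
    refine (intervalIntegral.intervalIntegrable_rpow' (r := -a) (by linarith)).congr fun y hy => ?_
    rw [Set.uIoc_of_le hx.le] at hy
    rw [abs_of_pos hy.1]
  rw [intervalIntegrable_iff_integrableOn_Icc_of_le (by norm_num)] at hint
  refine lt_of_eq_of_lt (setLIntegral_congr_fun_ae measurableSet_Icc ?_) hint.lintegral_lt_top
  filter_upwards [Measure.ae_ne volume (0 : ℝ)] with y hy _
  have : 0 < |y| := abs_pos.mpr hy
  rw [← ENNReal.ofReal_inv_of_pos (by positivity), Real.rpow_neg this.le]

theorem exists_lintegral_inv_abs_sub_rpow_le {a : ℝ} (ha0 : 0 ≤ a) (ha : a < 1) :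
    ∃ C : ℝ≥0∞, C ≠ ∞ ∧ ∀ x : ℝ,
      ∫⁻ s in Set.Icc (0 : ℝ) 1, (ENNReal.ofReal (|s - x| ^ a))⁻¹ ≤ C := by
  set f : ℝ → ℝ≥0∞ := fun y => (ENNReal.ofReal (|y| ^ a))⁻¹
  set h : ℝ → ℝ≥0∞ := (Set.Icc (-1 : ℝ) 1).indicator f
  have hh : ∫⁻ y, h y = ∫⁻ y in Set.Icc (-1 : ℝ) 1, f y := lintegral_indicator measurableSet_Icc _
  have hle (y : ℝ) : f y ≤ h y + 1 := by
    by_cases hy : y ∈ Set.Icc (-1 : ℝ) 1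
    · rw [show h y = f y from Set.indicator_of_mem hy _]
      exact le_self_add
    · have : 1 ≤ |y| := not_lt.mp fun hlt => hy (abs_le.mp hlt.le)
      exact le_add_left <| ENNReal.inv_le_one.mpr <|
        ENNReal.one_le_ofReal.mpr (Real.one_le_rpow this ha0)
  refine ⟨(∫⁻ y in Set.Icc (-1 : ℝ) 1, f y) + 1,
    ENNReal.add_ne_top.mpr ⟨(lintegral_inv_abs_rpow_lt_top ha).ne, ENNReal.one_ne_top⟩,
    fun x => ?_⟩
  calc ∫⁻ s in Set.Icc (0 : ℝ) 1, f (s - x)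
      ≤ ∫⁻ s in Set.Icc (0 : ℝ) 1, (h (s - x) + 1) := lintegral_mono fun s => hle _
    _ = (∫⁻ s in Set.Icc (0 : ℝ) 1, h (s - x)) + 1 := by
        rw [lintegral_add_right _ measurable_const]
        simp
    _ ≤ (∫⁻ s, h (s - x)) + 1 := by
        gcongr
        exact Measure.restrict_le_self
    _ = _ := by rw [lintegral_sub_right_eq_self, hh]

open Polynomial in
/-- The `z` in the statement is a complex root of `p` whose real part is closest to `s`. -/
theorem exists_mem_roots_abs_sub_re_pow_le {p : ℝ[X]} (hp : p.Monic) (hdeg : 0 < p.natDegree)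
    (s : ℝ) : ∃ z ∈ (p.map (algebraMap ℝ ℂ)).roots, |s - z.re| ^ p.natDegree ≤ |p.eval s| := by
  set pc := p.map (algebraMap ℝ ℂ)
  have hsplits : pc.Splits := IsAlgClosed.splits pc
  have hcard : p.natDegree = Multiset.card pc.roots := by
    rw [← hsplits.natDegree_eq_card_roots, natDegree_map]
  have heval : |p.eval s| = (pc.roots.map fun z => ‖(s : ℂ) - z‖).prod := by
    have h : ((p.eval s : ℝ) : ℂ) = (pc.roots.map fun z => (s : ℂ) - z).prod := by
      rw [← hsplits.eval_eq_prod_roots_of_monic (hp.map _) (s : ℂ), eval_map]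
      exact (eval₂_at_apply (algebraMap ℝ ℂ) s).symm
    rw [← Real.norm_eq_abs, ← Complex.norm_real, h]
    exact (map_multiset_prod (normHom : ℂ →*₀ ℝ) _).trans (by rw [Multiset.map_map]; rfl)
  have hne : pc.roots.toFinset.Nonempty := by
    rwa [Multiset.toFinset_nonempty, ← Multiset.card_pos, ← hcard]
  obtain ⟨z, hz, hmin⟩ := Finset.exists_min_image _ (fun z : ℂ => |s - z.re|) hne
  refine ⟨z, Multiset.mem_toFinset.mp hz, ?_⟩
  calc |s - z.re| ^ p.natDegree = (pc.roots.map fun _ => |s - z.re|).prod := by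
        rw [hcard, Multiset.map_const', Multiset.prod_replicate]
    _ ≤ (pc.roots.map fun w => ‖(s : ℂ) - w‖).prod := by
        refine Multiset.prod_map_le_prod_map₀ _ _ (fun _ _ => abs_nonneg _) fun w hw => ?_
        refine (hmin w (Multiset.mem_toFinset.mpr hw)).trans ?_
        simpa using Complex.abs_re_le_norm ((s : ℂ) - w)
    _ = |p.eval s| := heval.symm

open Polynomial in
theorem exists_lintegral_inv_abs_eval_rpow_le {m : ℕ} (hm : 0 < m) {a : ℝ} (ha0 : 0 ≤ a)
    (ha : a < 1) :
    ∃ C : ℝ≥0∞, C ≠ ∞ ∧ ∀ p : ℝ[X], p.Monic → p.natDegree = m →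
      ∫⁻ s in Set.Icc (0 : ℝ) 1, (ENNReal.ofReal (|p.eval s| ^ (a / m)))⁻¹ ≤ C := by
  obtain ⟨C, hC, hCb⟩ := exists_lintegral_inv_abs_sub_rpow_le ha0 ha
  refine ⟨m * C, by finiteness, fun p hp hpm => ?_⟩
  set roots := (p.map (algebraMap ℝ ℂ)).roots
  have hle (s : ℝ) : (ENNReal.ofReal (|p.eval s| ^ (a / m)))⁻¹ ≤
      ∑ z ∈ roots.toFinset, (ENNReal.ofReal (|s - z.re| ^ a))⁻¹ := by
    obtain ⟨z, hz, hzs⟩ := exists_mem_roots_abs_sub_re_pow_le hp (hpm ▸ hm) s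
    refine le_trans ?_ (Finset.single_le_sum
      (f := fun z : ℂ => (ENNReal.ofReal (|s - z.re| ^ a))⁻¹)
      (fun _ _ => zero_le) (Multiset.mem_toFinset.mpr hz))
    refine ENNReal.inv_le_inv.mpr (ENNReal.ofReal_le_ofReal ?_)
    calc |s - z.re| ^ a = (|s - z.re| ^ m) ^ (a / m) := by
          rw [← Real.rpow_natCast, ← Real.rpow_mul (abs_nonneg _)]
          congr 1
          field_simp
      _ ≤ _ := Real.rpow_le_rpow (by positivity) (hpm ▸ hzs) (by positivity)
  calc _ ≤ ∫⁻ s in Set.Icc (0 : ℝ) 1,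
        ∑ z ∈ roots.toFinset, (ENNReal.ofReal (|s - z.re| ^ a))⁻¹ := lintegral_mono hle
    _ = ∑ z ∈ roots.toFinset, ∫⁻ s in Set.Icc (0 : ℝ) 1, (ENNReal.ofReal (|s - z.re| ^ a))⁻¹ :=
        lintegral_finsetSum _ fun _ _ => by fun_prop
    _ ≤ ∑ _ ∈ roots.toFinset, C := Finset.sum_le_sum fun z _ => hCb z.re
    _ ≤ m * C := by
        rw [Finset.sum_const, nsmul_eq_mul]
        gcongr
        exact (Multiset.toFinset_card_le _).trans
          ((card_roots' _).trans (natDegree_map_le.trans hpm.le))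

theorem exists_lintegral_inv_abs_det_add_smul_one_rpow_le (n : Type*) [Fintype n] [DecidableEq n]
    [Nonempty n] {a : ℝ} (ha0 : 0 ≤ a) (ha : a < 1) :
    ∃ C : ℝ≥0∞, C ≠ ∞ ∧ ∀ N : Matrix n n ℝ, ∫⁻ s in Set.Icc (0 : ℝ) 1,
      (ENNReal.ofReal (|(N + s • (1 : Matrix n n ℝ)).det| ^ (a / Fintype.card n)))⁻¹ ≤ C := by
  obtain ⟨C, hC, h⟩ := exists_lintegral_inv_abs_eval_rpow_le (Fintype.card_pos (α := n)) ha0 ha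
  refine ⟨C, hC, fun N => ?_⟩
  have heval (s : ℝ) : (-N).charpoly.eval s = (N + s • (1 : Matrix n n ℝ)).det := by
    rw [eval_charpoly, sub_neg_eq_add, add_comm, scalar_apply, ← smul_one_eq_diagonal]
  simpa only [heval] using h (-N).charpoly (charpoly_monic _) (charpoly_natDegree_eq_dim _)

theorem setLIntegral_le_mul_of_lintegral_add_smul_le {E : Type*} [AddCommGroup E] [Module ℝ E]
    [TopologicalSpace E] [IsTopologicalAddGroup E] [ContinuousSMul ℝ E]
    [SecondCountableTopology E] [MeasurableSpace E] [BorelSpace E] {μ : Measure E} [SFinite μ]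
    [μ.IsAddRightInvariant] {f : E → ℝ≥0∞} (hf : Measurable f) {v : E} {C : ℝ≥0∞}
    (hC : ∀ y, ∫⁻ s in Set.Icc (0 : ℝ) 1, f (y + s • v) ≤ C) {B B' : Set E}
    (hB : MeasurableSet B) (hB' : MeasurableSet B')
    (hBB' : ∀ s ∈ Set.Icc (0 : ℝ) 1, ∀ z, z + s • v ∈ B → z ∈ B') :
    ∫⁻ z in B, f z ∂μ ≤ C * μ B' := by
  have hmeas : Measurable fun p : ℝ × E => f (p.2 + p.1 • v) :=
    hf.comp (by fun_prop : Continuous fun p : ℝ × E => p.2 + p.1 • v).measurable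
  have htranslate (s : ℝ) (hs : s ∈ Set.Icc (0 : ℝ) 1) :
      ∫⁻ z in B, f z ∂μ ≤ ∫⁻ z in B', f (z + s • v) ∂μ := by
    rw [← lintegral_indicator hB, ← lintegral_indicator hB',
      ← lintegral_add_right_eq_self _ (s • v)]
    refine lintegral_mono fun z => ?_
    by_cases hz : z + s • v ∈ B
    · rw [Set.indicator_of_mem hz, Set.indicator_of_mem (hBB' s hs z hz)]
    · rw [Set.indicator_of_notMem hz]
      exact zero_le
  calc ∫⁻ z in B, f z ∂μ = ∫⁻ _ in Set.Icc (0 : ℝ) 1, ∫⁻ z in B, f z ∂μ := by simp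
    _ ≤ ∫⁻ s in Set.Icc (0 : ℝ) 1, ∫⁻ z in B', f (z + s • v) ∂μ :=
        setLIntegral_mono' measurableSet_Icc htranslate
    _ = ∫⁻ z in B', (∫⁻ s in Set.Icc (0 : ℝ) 1, f (z + s • v)) ∂μ :=
        lintegral_lintegral_swap hmeas.aemeasurable
    _ ≤ ∫⁻ _ in B', C ∂μ := lintegral_mono hC
    _ = C * μ B' := setLIntegral_const _ _

end SingularIntegrals

section HaarUnitary

variable (𝔽 : Type*) [NormedDivisionRing 𝔽] [NormedAlgebra ℝ 𝔽] [StarRing 𝔽]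
  [IsRealComplexOrQuaternion 𝔽] {q : ℕ}

instance instSecondCountableMatrix : SecondCountableTopology (Matrix (Fin q) (Fin q) 𝔽) :=
  haveI : ProperSpace 𝔽 := FiniteDimensional.proper ℝ 𝔽
  inferInstanceAs (SecondCountableTopology (Fin q → Fin q → 𝔽))

instance instLocallyCompactMatrix : LocallyCompactSpace (Matrix (Fin q) (Fin q) 𝔽) :=
  haveI : ProperSpace 𝔽 := FiniteDimensional.proper ℝ 𝔽
  inferInstanceAs (LocallyCompactSpace (Fin q → Fin q → 𝔽))

instance instIsHaarMeasureHaarUnitary : (haarUnitary 𝔽 q).IsHaarMeasure :=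
  inferInstanceAs (Measure.haarMeasure ⊤).IsHaarMeasure

instance instIsProbabilityMeasureHaarUnitary : IsProbabilityMeasure (haarUnitary 𝔽 q) :=
  ⟨Measure.haarMeasure_self⟩

instance instIsMulRightInvariantHaarUnitary : (haarUnitary 𝔽 q).IsMulRightInvariant where
  map_mul_right_eq_self k := by
    have : IsProbabilityMeasure ((haarUnitary 𝔽 q).map (· * k)) :=
      Measure.isProbabilityMeasure_map (by fun_prop)
    exact Measure.isHaarMeasure_eq_of_isProbabilityMeasure _ _

/-- The exponent in the singular integrals of the minors, half the inverse size of the realified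
block. -/
def minorExponent (r : Fin q) : ℝ :=
  1 / 2 / Fintype.card (Fin (r + 1) × Fin (Module.finrank ℝ 𝔽))

theorem minorExponent_pos (r : Fin q) : 0 < minorExponent 𝔽 r := by
  have : NeZero (Module.finrank ℝ 𝔽) := ⟨Module.finrank_pos.ne'⟩
  have : 0 < Fintype.card (Fin (r + 1) × Fin (Module.finrank ℝ 𝔽)) := Fintype.card_pos
  rw [minorExponent]
  positivity

variable {𝔽}

/-- A small negative power of the realified minor, infinite where the latter vanishes. -/
def invMinorPow (r : Fin q) (g : Matrix (Fin q) (Fin q) 𝔽) : ℝ≥0∞ :=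
  (ENNReal.ofReal (|realMinor g r| ^ minorExponent 𝔽 r))⁻¹

theorem continuous_realMinor (r : Fin q) :
    Continuous fun g : Matrix (Fin q) (Fin q) 𝔽 => realMinor g r :=
  ((continuous_realMat.comp (continuous_id.matrix_submatrix _ _)).matrix_submatrix _ _).matrix_det

theorem measurable_invMinorPow (r : Fin q) :
    Measurable (invMinorPow r : Matrix (Fin q) (Fin q) 𝔽 → ℝ≥0∞) := by
  have := (continuous_realMinor (𝔽 := 𝔽) r).measurable
  unfold invMinorPow
  fun_prop

theorem invMinorPow_mul_of_blockTriangular (x : Matrix (Fin q) (Fin q) 𝔽)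
    {b : Matrix (Fin q) (Fin q) 𝔽} (hb : b.BlockTriangular id) (r : Fin q) :
    invMinorPow r (x * b) = invMinorPow r x * invMinorPow r b := by
  have h : realMinor (x * b) r = realMinor x r * realMinor b r := by
    rw [realMinor, realCols_mul_of_blockTriangular x hb,
      submatrix_mul _ _ _ _ _ Function.bijective_id, det_mul]
    rfl
  rw [invMinorPow, h, abs_mul, Real.mul_rpow (abs_nonneg _) (abs_nonneg _),
    ENNReal.ofReal_mul (by positivity),
    ENNReal.mul_inv (Or.inr ENNReal.ofReal_ne_top) (Or.inl ENNReal.ofReal_ne_top)]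
  rfl

theorem exists_lintegral_invMinorPow_add_smul_one_le (r : Fin q) :
    ∃ C : ℝ≥0∞, C ≠ ∞ ∧ ∀ y : Matrix (Fin q) (Fin q) 𝔽,
      ∫⁻ s in Set.Icc (0 : ℝ) 1, invMinorPow r (y + s • (1 : Matrix (Fin q) (Fin q) 𝔽)) ≤ C := by
  have : NeZero (Module.finrank ℝ 𝔽) := ⟨Module.finrank_pos.ne'⟩
  obtain ⟨C, hC, h⟩ := exists_lintegral_inv_abs_det_add_smul_one_rpow_le
    (Fin (r + 1) × Fin (Module.finrank ℝ 𝔽)) (a := 1 / 2) (by norm_num) (by norm_num)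
  refine ⟨C, hC, fun y => ?_⟩
  have hone (s : ℝ) : realMat (s • (1 : Matrix (Fin q) (Fin q) 𝔽)) =
      s • (1 : Matrix (Fin q × Fin (Module.finrank ℝ 𝔽)) _ ℝ) := by
    rw [smul_one_eq_diagonal, ← realMat_diagonal_algebraMap (𝔽 := 𝔽) fun _ => s]
    congr 1
    ext i j
    simp [diagonal_apply, one_apply, Algebra.algebraMap_eq_smul_one]
  have hminor (s : ℝ) : realMinor (y + s • (1 : Matrix (Fin q) (Fin q) 𝔽)) r =
      ((realMat y).submatrix (leadingIndex r) (leadingIndex r) + s • 1).det := by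
    rw [← submatrix_one _ (leadingIndex_injective r), realMinor, realCols, realMat_submatrix,
      realMat_add, hone]
    rfl
  simpa only [invMinorPow, hminor, minorExponent] using h _

theorem exists_setLIntegral_invMinorPow_unitary_mul_le
    (μ : Measure (Matrix (Fin q) (Fin q) 𝔽)) [μ.IsAddHaarMeasure]
    {B : Set (Matrix (Fin q) (Fin q) 𝔽)} (hB : IsCompact B) (r : Fin q) :
    ∃ C : ℝ≥0∞, C ≠ ∞ ∧ ∀ u : UnitaryGroup 𝔽 q,
      ∫⁻ z in B, invMinorPow r ((u : Matrix (Fin q) (Fin q) 𝔽) * z) ∂μ ≤ C := by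
  obtain ⟨C, hC, hCb⟩ := exists_lintegral_invMinorPow_add_smul_one_le (𝔽 := 𝔽) r
  let F : Matrix (Fin q) (Fin q) 𝔽 × ℝ × UnitaryGroup 𝔽 q → Matrix (Fin q) (Fin q) 𝔽 :=
    fun p => p.1 - p.2.1 • star (p.2.2 : Matrix (Fin q) (Fin q) 𝔽)
  have hB' : IsCompact (F '' (B ×ˢ Set.Icc (0 : ℝ) 1 ×ˢ Set.univ)) :=
    (hB.prod (isCompact_Icc.prod isCompact_univ)).image (by fun_prop)
  refine ⟨C * μ (F '' (B ×ˢ Set.Icc (0 : ℝ) 1 ×ˢ Set.univ)),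
    ENNReal.mul_ne_top hC hB'.measure_ne_top, fun u => ?_⟩
  refine setLIntegral_le_mul_of_lintegral_add_smul_le
    (f := fun z => invMinorPow r ((u : Matrix (Fin q) (Fin q) 𝔽) * z))
    (v := star (u : Matrix (Fin q) (Fin q) 𝔽))
    ((measurable_invMinorPow r).comp (continuous_const.mul continuous_id).measurable)
    (fun y => ?_) hB.measurableSet hB'.measurableSet
    fun s hs z hz => ⟨(_, s, u), ⟨hz, hs, Set.mem_univ _⟩, add_sub_cancel_right _ _⟩
  simpa only [mul_add, mul_smul_comm, Unitary.mul_star_self_of_mem u.2] using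
    hCb ((u : Matrix (Fin q) (Fin q) 𝔽) * y)

/-- By Fubini the integral over `u` of `invMinorPow r (u z)` is finite for almost every `z` in a
compact neighbourhood of `0`; the QR decomposition of one such `z` then removes the `z`. -/
theorem lintegral_invMinorPow_lt_top (r : Fin q) :
    ∫⁻ u : UnitaryGroup 𝔽 q, invMinorPow r (u : Matrix (Fin q) (Fin q) 𝔽) ∂(haarUnitary 𝔽 q)
      < ∞ := by
  let μ : Measure (Matrix (Fin q) (Fin q) 𝔽) := Measure.addHaar
  obtain ⟨B, hBc, hB0⟩ := exists_compact_mem_nhds (0 : Matrix (Fin q) (Fin q) 𝔽)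
  obtain ⟨C, hC, hCb⟩ := exists_setLIntegral_invMinorPow_unitary_mul_le μ hBc r
  have hmeas : Measurable fun p : UnitaryGroup 𝔽 q × Matrix (Fin q) (Fin q) 𝔽 =>
      invMinorPow r ((p.1 : Matrix (Fin q) (Fin q) 𝔽) * p.2) :=
    (measurable_invMinorPow r).comp (Continuous.measurable (by fun_prop))
  have hfin : ∫⁻ z in B, ∫⁻ u : UnitaryGroup 𝔽 q,
      invMinorPow r ((u : Matrix (Fin q) (Fin q) 𝔽) * z) ∂(haarUnitary 𝔽 q) ∂μ ≠ ∞ := by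
    rw [← lintegral_lintegral_swap hmeas.aemeasurable]
    refine ne_top_of_le_ne_top hC ((lintegral_mono hCb).trans_eq ?_)
    rw [lintegral_const, measure_univ, mul_one]
  have : (ae (μ.restrict B)).NeBot := by
    rw [ae_neBot, Ne, Measure.restrict_eq_zero]
    exact (Measure.measure_pos_of_mem_nhds μ hB0).ne'
  obtain ⟨z, hz⟩ := (ae_lt_top hmeas.lintegral_prod_left' hfin).exists
  obtain ⟨k, b, rfl, hb⟩ := exists_unitary_mul_blockTriangular z
  simp only [← mul_assoc, invMinorPow_mul_of_blockTriangular _ hb] at hz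
  have hmeas_k : Measurable fun u : UnitaryGroup 𝔽 q =>
      invMinorPow r ((u : Matrix (Fin q) (Fin q) 𝔽) * (k : Matrix (Fin q) (Fin q) 𝔽)) :=
    (measurable_invMinorPow r).comp (Continuous.measurable (by fun_prop))
  rw [lintegral_mul_const _ hmeas_k] at hz
  have hb0 : invMinorPow r b ≠ 0 := ENNReal.inv_ne_zero.mpr ENNReal.ofReal_ne_top
  rw [← lintegral_mul_right_eq_self
    (fun u : UnitaryGroup 𝔽 q => invMinorPow r (u : Matrix (Fin q) (Fin q) 𝔽)) k]
  exact ENNReal.lt_top_of_mul_ne_top_left hz.ne hb0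

theorem sq_log_le_div_mul_inv_rpow {x δ : ℝ} (hx : 0 < x) (hx1 : x ≤ 1) (hδ : 0 < δ) :
    Real.log x ^ 2 ≤ 2 / δ ^ 2 * (x ^ δ)⁻¹ := by
  have hy : 0 ≤ δ * -Real.log x := mul_nonneg hδ.le (neg_nonneg.mpr (Real.log_nonpos hx.le hx1))
  have hexp : (x ^ δ)⁻¹ = Real.exp (δ * -Real.log x) := by
    rw [Real.rpow_def_of_pos hx, ← Real.exp_neg]
    congr 1
    ring
  rw [hexp, div_mul_eq_mul_div, le_div_iff₀ (by positivity)]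
  linarith [Real.quadratic_le_exp_of_nonneg hy]

theorem ofReal_sq_partialSum_sub_logMinor_le {t : Fin q → ℝ} (ht : Antitone t)
    (u : UnitaryGroup 𝔽 q) (r : Fin q) :
    ENNReal.ofReal
        ((partialSum t r - logMinor (expDiag 𝔽 t * (u : Matrix (Fin q) (Fin q) 𝔽)) r) ^ 2) ≤
      ENNReal.ofReal (2 / minorExponent 𝔽 r ^ 2) *
        invMinorPow r (u : Matrix (Fin q) (Fin q) 𝔽) := by
  have hδ := minorExponent_pos 𝔽 r
  by_cases h0 : realMinor (u : Matrix (Fin q) (Fin q) 𝔽) r = 0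
  · rw [invMinorPow, h0, abs_zero, Real.zero_rpow hδ.ne', ENNReal.ofReal_zero, ENNReal.inv_zero,
      ENNReal.mul_top (ENNReal.ofReal_pos.mpr (by positivity)).ne']
    exact le_top
  have hx : 0 < |realMinor (u : Matrix (Fin q) (Fin q) 𝔽) r| := abs_pos.mpr h0
  have hx1 := abs_realMinor_unitary_le_one u r
  have hupp := logMinor_expDiag_mul_le ht u r
  have hlow := le_logMinor_expDiag_mul t (u : Matrix (Fin q) (Fin q) 𝔽) h0
  have hsq := sq_log_le_div_mul_inv_rpow hx hx1 hδ
  set x := |realMinor (u : Matrix (Fin q) (Fin q) 𝔽) r|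
  have hd : 1 / (Module.finrank ℝ 𝔽 : ℝ) * -Real.log x ≤ -Real.log x := by
    refine mul_le_of_le_one_left (neg_nonneg.mpr (Real.log_nonpos hx.le hx1)) ?_
    exact div_le_one_of_le₀ (by exact_mod_cast Module.finrank_pos) (Nat.cast_nonneg _)
  rw [invMinorPow, ← ENNReal.ofReal_inv_of_pos (by positivity),
    ← ENNReal.ofReal_mul (by positivity)]
  refine ENNReal.ofReal_le_ofReal (le_trans (sq_le_sq.mpr ?_) hsq)
  rw [abs_of_nonneg (by linarith), abs_of_nonpos (Real.log_nonpos hx.le hx1)]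
  linarith

theorem exists_lintegral_sq_partialSum_sub_logMinor_le (r : Fin q) :
    ∃ C : ℝ≥0∞, C ≠ ∞ ∧ ∀ t : Fin q → ℝ, Antitone t → ∀ l : UnitaryGroup 𝔽 q,
      ∫⁻ u : UnitaryGroup 𝔽 q, ENNReal.ofReal ((partialSum t r -
        logMinor (expDiag 𝔽 t * ((l * u : UnitaryGroup 𝔽 q) : Matrix (Fin q) (Fin q) 𝔽)) r) ^ 2)
        ∂(haarUnitary 𝔽 q) ≤ C := by
  refine ⟨ENNReal.ofReal (2 / minorExponent 𝔽 r ^ 2) * _,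
    ENNReal.mul_ne_top ENNReal.ofReal_ne_top (lintegral_invMinorPow_lt_top (𝔽 := 𝔽) r).ne,
    fun t ht l => ?_⟩
  rw [lintegral_mul_left_eq_self (fun u : UnitaryGroup 𝔽 q => ENNReal.ofReal ((partialSum t r -
      logMinor (expDiag 𝔽 t * (u : Matrix (Fin q) (Fin q) 𝔽)) r) ^ 2)) l,
    ← lintegral_const_mul' _ _ ENNReal.ofReal_ne_top]
  exact lintegral_mono fun u => ofReal_sq_partialSum_sub_logMinor_le ht u r

end HaarUnitary

section Increments

variable {q : ℕ}

/-- The increments of a finite sequence, starting from the value `0`; the inverse of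
`partialSum`. -/
def incr : (Fin q → ℝ) →L[ℝ] (Fin q → ℝ) :=
  ContinuousLinearMap.pi fun j => ContinuousLinearMap.proj j -
    if h : 0 < (j : ℕ) then ContinuousLinearMap.proj ⟨j - 1, by omega⟩ else 0

theorem incr_apply (F : Fin q → ℝ) (j : Fin q) :
    incr F j = F j - if h : 0 < (j : ℕ) then F ⟨j - 1, by omega⟩ else 0 := by
  rw [incr, ContinuousLinearMap.pi_apply, _root_.sub_apply]
  split_ifs <;> rfl

theorem incr_partialSum (t : Fin q → ℝ) : incr (partialSum t) = t := by
  ext ⟨j, hj⟩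
  rw [incr_apply]
  cases j with
  | zero =>
    simp only [partialSum, lt_irrefl, dite_false, sub_zero]
    exact Fin.sum_univ_one _
  | succ j =>
    rw [dif_pos j.succ_pos, partialSum, Fin.sum_univ_castSucc]
    exact add_sub_cancel_left _ _

theorem sum_mul_sub_succ_eq_sum_incr_mul (F : Fin q → ℝ) (μ : Fin q → ℂ) :
    ∑ r, (F r : ℂ) * (μ r - if h : (r : ℕ) + 1 < q then μ ⟨r + 1, h⟩ else 0) =
      ∑ j, (incr F j : ℂ) * μ j := by
  cases q with
  | zero => simp
  | succ n =>
    have hshift : ∑ r : Fin (n + 1), (F r : ℂ) * (if h : (r : ℕ) + 1 < n + 1 then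
          μ ⟨r + 1, h⟩ else 0) =
        ∑ j : Fin (n + 1),
          ((if h : 0 < (j : ℕ) then F ⟨j - 1, by omega⟩ else 0 : ℝ) : ℂ) * μ j := by
      rw [Fin.sum_univ_castSucc, Fin.sum_univ_succ]
      simp [Fin.succ, Fin.castSucc, Fin.castAdd, Fin.castLE]
    simp only [incr_apply, mul_sub, Finset.sum_sub_distrib, hshift, Complex.ofReal_sub, sub_mul]

end Increments

section MomentFunction

variable {𝔽 : Type*} [NormedDivisionRing 𝔽] [NormedAlgebra ℝ 𝔽] [StarRing 𝔽]
  [IsRealComplexOrQuaternion 𝔽] {q : ℕ}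

theorem continuous_realMinor_star_mul_self (r : Fin q) :
    Continuous fun g : Matrix (Fin q) (Fin q) 𝔽 => realMinor (star g * g) r :=
  (continuous_realMinor r).comp (by fun_prop)

theorem measurable_logMinor : Measurable (logMinor : Matrix (Fin q) (Fin q) 𝔽 → Fin q → ℝ) := by
  refine measurable_pi_lambda _ fun r => ?_
  simp only [logMinor_eq_log_realMinor]
  exact (continuous_realMinor_star_mul_self r).measurable.log.const_mul _

theorem continuous_logMinor_comp {α : Type*} [TopologicalSpace α]
    {f : α → Matrix (Fin q) (Fin q) 𝔽} (hf : Continuous f) (hu : ∀ a, IsUnit (f a)) :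
    Continuous fun a => logMinor (f a) := by
  refine continuous_pi fun r => ?_
  simp only [logMinor_eq_log_realMinor]
  exact continuous_const.mul (((continuous_realMinor_star_mul_self r).comp hf).log
    fun a => (realMinor_star_mul_self_pos (hu a) r).ne')

variable (𝔽) in
theorem continuous_logMinor_expDiag_mul :
    Continuous fun p : (Fin q → ℝ) × UnitaryGroup 𝔽 q =>
      logMinor (expDiag 𝔽 p.1 * (p.2 : Matrix (Fin q) (Fin q) 𝔽)) := by
  refine continuous_logMinor_comp (.mul ?_ (by fun_prop)) fun p => isUnit_expDiag_mul p.1 p.2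
  have := continuous_algebraMap ℝ 𝔽
  exact (continuous_pi fun i => this.comp (by fun_prop)).matrix_diagonal

theorem continuous_logMinor_expDiag_mul_right (t : Fin q → ℝ) :
    Continuous fun u : UnitaryGroup 𝔽 q =>
      logMinor (expDiag 𝔽 t * (u : Matrix (Fin q) (Fin q) 𝔽)) :=
  continuous_logMinor_comp (continuous_const.mul continuous_subtype_val)
    fun u => isUnit_expDiag_mul t u

theorem norm_logMinor_expDiag_mul_le (t : Fin q → ℝ) (u : UnitaryGroup 𝔽 q) :
    ‖logMinor (expDiag 𝔽 t * (u : Matrix (Fin q) (Fin q) 𝔽))‖ ≤ q * ∑ i, |t i| :=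
  (pi_norm_le_iff_of_nonneg (by positivity)).mpr fun r => abs_logMinor_expDiag_mul_le t u r

variable (𝔽) in
/-- The mean of `logMinor (e^t u)` over the Haar distributed unitary matrix `u`. -/
def meanLogMinor (t : Fin q → ℝ) : Fin q → ℝ :=
  ∫ u : UnitaryGroup 𝔽 q, logMinor (expDiag 𝔽 t * (u : Matrix (Fin q) (Fin q) 𝔽)) ∂haarUnitary 𝔽 q

theorem stronglyMeasurable_meanLogMinor :
    StronglyMeasurable (meanLogMinor 𝔽 : (Fin q → ℝ) → Fin q → ℝ) :=
  (continuous_logMinor_expDiag_mul 𝔽).measurable.stronglyMeasurable.integral_prod_right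

theorem norm_meanLogMinor_le (t : Fin q → ℝ) : ‖meanLogMinor 𝔽 t‖ ≤ q * ∑ i, |t i| := by
  simpa [meanLogMinor] using norm_integral_le_of_norm_le_const (μ := haarUnitary 𝔽 q)
    (ae_of_all _ fun u => norm_logMinor_expDiag_mul_le t u)

theorem powerFunction_star_mul_self {g : Matrix (Fin q) (Fin q) 𝔽} (hg : IsUnit g)
    (μ : Fin q → ℂ) :
    powerFunction μ (star g * g) = Complex.exp (2 * ∑ j, (incr (logMinor g) j : ℂ) * μ j) := by
  have hlog (r : Fin q) : Complex.log (minor (star g * g) r) = 2 * (logMinor g r : ℂ) := by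
    rw [← Complex.ofReal_log (minor_star_mul_self_pos hg r).le, logMinor]
    push_cast
    ring
  have hne (r : Fin q) : (minor (star g * g) r : ℂ) ≠ 0 :=
    Complex.ofReal_ne_zero.mpr (minor_star_mul_self_pos hg r).ne'
  simp only [powerFunction, Complex.cpow_def_of_ne_zero (hne _), hlog]
  rw [← Complex.exp_sum, ← sum_mul_sub_succ_eq_sum_incr_mul, Finset.mul_sum]
  simp only [mul_assoc]

theorem spherical_eq_integral (μ : Fin q → ℂ) (t : Fin q → ℝ) :
    spherical 𝔽 μ t = ∫ u : UnitaryGroup 𝔽 q, Complex.exp (∑ j,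
      (incr (logMinor (expDiag 𝔽 t * (u : Matrix (Fin q) (Fin q) 𝔽))) j : ℂ) *
        (Complex.I * μ j - halfSum 𝔽 j)) ∂haarUnitary 𝔽 q := by
  rw [spherical]
  congr 1 with u
  have hsq : (realDiag (fun i => Real.exp (2 * t i)) : Matrix (Fin q) (Fin q) 𝔽) =
      star (expDiag 𝔽 t) * expDiag 𝔽 t := by
    have hstar : star (expDiag 𝔽 t) = expDiag 𝔽 t := star_realDiag _
    rw [hstar, expDiag_mul_expDiag, ← two_smul ℝ t]
    rfl
  rw [hsq, ← mul_assoc, ← star_mul, mul_assoc, powerFunction_star_mul_self (isUnit_expDiag_mul t u),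
    Finset.mul_sum]
  congr 1
  exact Finset.sum_congr rfl fun j _ => by ring

theorem spherical_eq_mgf (t : Fin q → ℝ) (j : Fin q) (s : ℝ) :
    spherical 𝔽 (fun l => -Complex.I * (halfSum 𝔽 l : ℂ)
      - Complex.I * (Pi.single j s : Fin q → ℝ) l) t =
      (mgf (fun u : UnitaryGroup 𝔽 q =>
        incr (logMinor (expDiag 𝔽 t * (u : Matrix (Fin q) (Fin q) 𝔽))) j)
        (haarUnitary 𝔽 q) s : ℂ) := by
  have hparam (l : Fin q) : Complex.I * (-Complex.I * (halfSum 𝔽 l : ℂ)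
      - Complex.I * (Pi.single j s : Fin q → ℝ) l) - halfSum 𝔽 l =
      ((Pi.single j s : Fin q → ℝ) l : ℂ) := by
    linear_combination
      (-(halfSum 𝔽 l : ℂ) - ((Pi.single j s : Fin q → ℝ) l : ℂ)) * Complex.I_mul_I
  rw [spherical_eq_integral, mgf, ← integral_complex_ofReal]
  simp only [hparam, ← Complex.ofReal_mul, ← Complex.ofReal_sum, ← Complex.ofReal_exp]
  simp [Pi.single_apply, mul_comm]

theorem momentFunction_eq_incr_meanLogMinor (t : Fin q → ℝ) :
    momentFunction 𝔽 t = incr (meanLogMinor 𝔽 t) := by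
  have hint : Integrable (fun u : UnitaryGroup 𝔽 q =>
      logMinor (expDiag 𝔽 t * (u : Matrix (Fin q) (Fin q) 𝔽))) (haarUnitary 𝔽 q) :=
    (continuous_logMinor_expDiag_mul_right t).integrable_of_hasCompactSupport
      (.of_compactSpace _)
  ext j
  set D : UnitaryGroup 𝔽 q → ℝ := fun u =>
    incr (logMinor (expDiag 𝔽 t * (u : Matrix (Fin q) (Fin q) 𝔽))) j
  have hD : Continuous D :=
    (continuous_apply j).comp (incr.continuous.comp (continuous_logMinor_expDiag_mul_right t))
  have hexp : integrableExpSet D (haarUnitary 𝔽 q) = Set.univ :=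
    Set.eq_univ_of_forall fun s =>
      Continuous.integrable_of_hasCompactSupport (by fun_prop) (.of_compactSpace _)
  have hderiv : HasDerivAt (mgf D (haarUnitary 𝔽 q)) (∫ u, D u ∂haarUnitary 𝔽 q) 0 := by
    simpa using hasDerivAt_mgf (X := D) (μ := haarUnitary 𝔽 q) (t := 0) (by simp [hexp])
  rw [momentFunction]
  simp only [spherical_eq_mgf]
  rw [hderiv.ofReal_comp.deriv, Complex.ofReal_re, meanLogMinor, ← incr.integral_comp_comm hint,
    eval_integral fun i => (incr.integrable_comp hint).eval i]

end MomentFunction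

section SingularSpectrum

variable {𝔽 : Type*} [NormedDivisionRing 𝔽] [NormedAlgebra ℝ 𝔽] [StarRing 𝔽]
  [IsRealComplexOrQuaternion 𝔽] {q : ℕ}

theorem logMinor_mul_le_partialSum (g : GL (Fin q) 𝔽) (u : UnitaryGroup 𝔽 q) (r : Fin q) :
    logMinor ((g : Matrix (Fin q) (Fin q) 𝔽) * (u : Matrix (Fin q) (Fin q) 𝔽)) r ≤
      partialSum (logSingularSpectrum g) r := by
  obtain ⟨k, l, hg⟩ := exists_eq_unitary_mul_expDiag_mul_unitary g
  rw [hg, mul_assoc, mul_assoc, logMinor_unitary_mul]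
  exact logMinor_expDiag_mul_le (antitone_logSingularSpectrum g) (l * u) r

theorem exists_logMinor_mul_eq_partialSum (g : GL (Fin q) 𝔽) :
    ∃ u : UnitaryGroup 𝔽 q,
      logMinor ((g : Matrix (Fin q) (Fin q) 𝔽) * (u : Matrix (Fin q) (Fin q) 𝔽)) =
        partialSum (logSingularSpectrum g) := by
  obtain ⟨k, l, hg⟩ := exists_eq_unitary_mul_expDiag_mul_unitary g
  refine ⟨star l, ?_⟩
  rw [hg, mul_assoc, mul_assoc, logMinor_unitary_mul, Unitary.coe_star,
    Unitary.mul_star_self_of_mem l.2, mul_one, logMinor_expDiag (antitone_logSingularSpectrum g)]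

theorem partialSum_logSingularSpectrum_eq_iSup (g : GL (Fin q) 𝔽) (r : Fin q) :
    partialSum (logSingularSpectrum g) r = ⨆ u : UnitaryGroup 𝔽 q,
      logMinor ((g : Matrix (Fin q) (Fin q) 𝔽) * (u : Matrix (Fin q) (Fin q) 𝔽)) r := by
  obtain ⟨u, hu⟩ := exists_logMinor_mul_eq_partialSum g
  refine le_antisymm ?_ (ciSup_le fun u => logMinor_mul_le_partialSum g u r)
  rw [← hu]
  exact le_ciSup (f := fun u : UnitaryGroup 𝔽 q =>
      logMinor ((g : Matrix (Fin q) (Fin q) 𝔽) * (u : Matrix (Fin q) (Fin q) 𝔽)) r)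
    ⟨_, Set.forall_mem_range.mpr fun u => logMinor_mul_le_partialSum g u r⟩ u

theorem measurable_partialSum_logSingularSpectrum (r : Fin q) :
    Measurable fun g : GL (Fin q) 𝔽 => partialSum (logSingularSpectrum g) r := by
  have : SecondCountableTopology (UnitaryGroup 𝔽 q) :=
    TopologicalSpace.Subtype.secondCountableTopology _
  obtain ⟨S, hS, hdense⟩ := TopologicalSpace.exists_countable_dense (UnitaryGroup 𝔽 q)
  have hcont (g : GL (Fin q) 𝔽) : Continuous fun u : UnitaryGroup 𝔽 q =>
      logMinor ((g : Matrix (Fin q) (Fin q) 𝔽) * (u : Matrix (Fin q) (Fin q) 𝔽)) r :=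
    (continuous_apply r).comp <| continuous_logMinor_comp
      (continuous_const.mul continuous_subtype_val)
      fun u => g.isUnit.mul (Unitary.toUnits u).isUnit
  simp only [partialSum_logSingularSpectrum_eq_iSup, ← hdense.ciSup' (hcont _)]
  have := hS.to_subtype
  refine .iSup fun u => (measurable_pi_apply r).comp (measurable_logMinor.comp ?_)
  exact (continuous_mul_const (u : Matrix (Fin q) (Fin q) 𝔽)).measurable.comp
    (comap_measurable Units.val)

theorem measurable_logSingularSpectrum :
    Measurable (logSingularSpectrum : GL (Fin q) 𝔽 → Fin q → ℝ) := by
  simpa only [Function.comp_def, incr_partialSum] using incr.measurable.comp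
    (measurable_pi_lambda (fun g : GL (Fin q) 𝔽 => partialSum (logSingularSpectrum g))
      measurable_partialSum_logSingularSpectrum)

theorem exists_logMinor_star_mul (g : GL (Fin q) 𝔽) :
    ∃ k : UnitaryGroup 𝔽 q, ∀ u : UnitaryGroup 𝔽 q,
      logMinor (star (g : Matrix (Fin q) (Fin q) 𝔽) * (u : Matrix (Fin q) (Fin q) 𝔽)) =
        logMinor (expDiag 𝔽 (logSingularSpectrum g) *
          ((k * u : UnitaryGroup 𝔽 q) : Matrix (Fin q) (Fin q) 𝔽)) := by
  obtain ⟨k, l, hg⟩ := exists_eq_unitary_mul_expDiag_mul_unitary g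
  refine ⟨star k, fun u => ?_⟩
  have hstar : star (expDiag 𝔽 (logSingularSpectrum g)) = expDiag 𝔽 (logSingularSpectrum g) :=
    star_realDiag _
  conv_lhs => rw [hg]
  rw [star_mul, star_mul, hstar, mul_assoc, ← Unitary.coe_star, logMinor_unitary_mul, mul_assoc]
  rfl

theorem norm_logMinor_star_mul_le (g : GL (Fin q) 𝔽) (u : UnitaryGroup 𝔽 q) :
    ‖logMinor (star (g : Matrix (Fin q) (Fin q) 𝔽) * (u : Matrix (Fin q) (Fin q) 𝔽))‖ ≤
      q * ∑ i, |logSingularSpectrum g i| := by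
  obtain ⟨k, hk⟩ := exists_logMinor_star_mul g
  rw [hk]
  exact norm_logMinor_expDiag_mul_le _ _

theorem integral_logMinor_star_mul (g : GL (Fin q) 𝔽) :
    ∫ u : UnitaryGroup 𝔽 q, logMinor (star (g : Matrix (Fin q) (Fin q) 𝔽) *
        (u : Matrix (Fin q) (Fin q) 𝔽)) ∂haarUnitary 𝔽 q =
      meanLogMinor 𝔽 (logSingularSpectrum g) := by
  obtain ⟨k, hk⟩ := exists_logMinor_star_mul g
  simp only [hk]
  exact integral_mul_left_eq_self (fun u : UnitaryGroup 𝔽 q =>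
    logMinor (expDiag 𝔽 (logSingularSpectrum g) * (u : Matrix (Fin q) (Fin q) 𝔽))) k

variable (𝔽) in
theorem exists_lintegral_sq_partialSum_sub_logMinor_star_mul_le (r : Fin q) :
    ∃ C : ℝ≥0∞, C ≠ ∞ ∧ ∀ g : GL (Fin q) 𝔽,
      ∫⁻ u : UnitaryGroup 𝔽 q, ENNReal.ofReal ((partialSum (logSingularSpectrum g) r -
        logMinor (star (g : Matrix (Fin q) (Fin q) 𝔽) *
          (u : Matrix (Fin q) (Fin q) 𝔽)) r) ^ 2) ∂haarUnitary 𝔽 q ≤ C := by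
  obtain ⟨C, hC, hbound⟩ := exists_lintegral_sq_partialSum_sub_logMinor_le (𝔽 := 𝔽) r
  refine ⟨C, hC, fun g => ?_⟩
  obtain ⟨k, hk⟩ := exists_logMinor_star_mul g
  simp only [hk]
  exact hbound _ (antitone_logSingularSpectrum g) k

end SingularSpectrum

section Kronecker

variable {E : Type*} [NormedAddCommGroup E] [NormedSpace ℝ E]

theorem sum_range_smul_sub {R M : Type*} [Ring R] [AddCommGroup M] [Module R M] (a : ℕ → R)
    (w : ℕ → M) (k : ℕ) :
    ∑ i ∈ Finset.range k, a (i + 1) • (w (i + 1) - w i) =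
      a k • w k - a 0 • w 0 - ∑ i ∈ Finset.range k, (a (i + 1) - a i) • w i := by
  induction k with
  | zero => simp
  | succ k ih =>
    rw [Finset.sum_range_succ, Finset.sum_range_succ, ih, smul_sub, sub_smul]
    abel

theorem isLittleO_sum_range_smul_of_tendsto_zero {a : ℕ → ℝ} {w : ℕ → E} (ha : Monotone a)
    (ha' : Tendsto a atTop atTop) (hw : Tendsto w atTop (𝓝 0)) :
    (fun k => ∑ i ∈ Finset.range k, (a (i + 1) - a i) • w i) =o[atTop] a := by
  have hstep : (fun i => (a (i + 1) - a i) • w i) =o[atTop] fun i => a (i + 1) - a i := by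
    simpa using (Asymptotics.isBigO_refl (fun i => a (i + 1) - a i) atTop).smul_isLittleO
      ((Asymptotics.isLittleO_one_iff ℝ).mpr hw)
  have hsum := hstep.sum_range (fun i => sub_nonneg.mpr (ha i.le_succ)) <| by
    simpa only [Finset.sum_range_sub, ← sub_eq_add_neg] using
      tendsto_atTop_add_const_right atTop (-a 0) ha'
  simp only [Finset.sum_range_sub] at hsum
  exact hsum.trans_isBigO ((Asymptotics.isBigO_refl a _).sub
    (Asymptotics.isLittleO_const_left.mpr (.inr (tendsto_norm_atTop_atTop.comp ha'))).isBigO)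

/-- Kronecker's lemma. -/
theorem tendsto_inv_smul_sum_of_tendsto_sum_inv_smul {a : ℕ → ℝ} {y : ℕ → E} {l : E}
    (ha : Monotone a) (ha' : Tendsto a atTop atTop) (ha0 : ∀ i, a (i + 1) ≠ 0)
    (h : Tendsto (fun k => ∑ i ∈ Finset.range k, (a (i + 1))⁻¹ • y i) atTop (𝓝 l)) :
    Tendsto (fun k => (a k)⁻¹ • ∑ i ∈ Finset.range k, y i) atTop (𝓝 0) := by
  set w : ℕ → E := fun k => ∑ i ∈ Finset.range k, (a (i + 1))⁻¹ • y i - l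
  have hw : Tendsto w atTop (𝓝 0) := by simpa using h.sub_const l
  have hy (i : ℕ) : y i = a (i + 1) • (w (i + 1) - w i) := by
    simp [w, Finset.sum_range_succ, smul_inv_smul₀ (ha0 i)]
  have hhead : (fun k => a k • w k) =o[atTop] a := by
    simpa using (Asymptotics.isBigO_refl a atTop).smul_isLittleO
      ((Asymptotics.isLittleO_one_iff ℝ).mpr hw)
  have hconst : (fun _ => a 0 • w 0) =o[atTop] a :=
    Asymptotics.isLittleO_const_left.mpr (.inr (tendsto_norm_atTop_atTop.comp ha'))
  refine Asymptotics.IsLittleO.tendsto_inv_smul_nhds_zero ?_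
  simp only [hy, sum_range_smul_sub]
  exact (hhead.sub hconst).sub (isLittleO_sum_range_smul_of_tendsto_zero ha ha' hw)

end Kronecker

section Independence

variable {Ω α β γ : Type*} [MeasurableSpace α] [MeasurableSpace β] [MeasurableSpace γ]

theorem measure_preimage_inter_of_forall_map_eq {m : MeasurableSpace Ω} [mΩ : MeasurableSpace Ω]
    {P : Measure Ω} [IsFiniteMeasure P] (hm : m ≤ mΩ) {X : Ω → α} (hX : Measurable X)
    (hind : Indep m (MeasurableSpace.comap X inferInstance) P) {W : Ω → β} (hW : Measurable[m] W)
    {ψ : α → β → γ} (hψ : Measurable (Function.uncurry ψ)) {μ : Measure γ}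
    (hlaw : ∀ ω, (P.map X).map (fun x => ψ x (W ω)) = μ) {A : Set Ω} (hA : MeasurableSet[m] A)
    {S : Set γ} (hS : MeasurableSet S) :
    P ((fun ω => ψ (X ω) (W ω)) ⁻¹' S ∩ A) = μ S * P A := by
  set V : Ω → β × Prop := fun ω => (W ω, ω ∈ A)
  have hV : Measurable[m] V := hW.prodMk (measurable_to_prop (by simpa using hA))
  have hVm : Measurable V := hV.mono hm le_rfl
  have hVX : IndepFun V X P := indep_of_indep_of_le_left hind hV.comap_le
  set T : Set ((β × Prop) × α) := {p | p.1.2 ∧ ψ p.2 p.1.1 ∈ S}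
  have hT : MeasurableSet T :=
    (measurable_snd.comp measurable_fst).setOf.inter
      ((hψ.comp (measurable_snd.prodMk (measurable_fst.comp measurable_fst))) hS)
  have hsection (ω : Ω) : P.map X (Prod.mk (V ω) ⁻¹' T) = A.indicator (fun _ => μ S) ω := by
    by_cases hω : ω ∈ A
    · have hψω : Measurable fun x => ψ x (W ω) := hψ.comp measurable_prodMk_right
      rw [Set.indicator_of_mem hω, ← hlaw ω, Measure.map_apply hψω hS]
      congr 1 with x
      simp [T, V, hω]
    · simp [T, V, hω]
  calc P ((fun ω => ψ (X ω) (W ω)) ⁻¹' S ∩ A)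
      = P.map (fun ω => (V ω, X ω)) T := by
        rw [Measure.map_apply (hVm.prodMk hX) hT, Set.inter_comm]
        rfl
    _ = ∫⁻ ω, P.map X (Prod.mk (V ω) ⁻¹' T) ∂P := by
        rw [(indepFun_iff_map_prod_eq_prod_map_map hVm.aemeasurable hX.aemeasurable).mp hVX,
          Measure.prod_apply hT, lintegral_map (measurable_measure_prodMk_left hT) hVm]
    _ = μ S * P A := by
        simp only [hsection]
        exact lintegral_indicator_const (hm _ hA) _

theorem map_eq_and_indep_of_forall_map_eq {m : MeasurableSpace Ω} [mΩ : MeasurableSpace Ω]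
    {P : Measure Ω} [IsProbabilityMeasure P] (hm : m ≤ mΩ) {X : Ω → α} (hX : Measurable X)
    (hind : Indep m (MeasurableSpace.comap X inferInstance) P) {W : Ω → β} (hW : Measurable[m] W)
    {ψ : α → β → γ} (hψ : Measurable (Function.uncurry ψ)) {μ : Measure γ}
    (hlaw : ∀ ω, (P.map X).map (fun x => ψ x (W ω)) = μ) :
    P.map (fun ω => ψ (X ω) (W ω)) = μ ∧
      Indep (MeasurableSpace.comap (fun ω => ψ (X ω) (W ω)) inferInstance) m P := by
  have hY : Measurable fun ω => ψ (X ω) (W ω) := hψ.comp (hX.prodMk (hW.mono hm le_rfl))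
  have hmap : P.map (fun ω => ψ (X ω) (W ω)) = μ := by
    ext S hS
    simpa [Measure.map_apply hY hS] using
      measure_preimage_inter_of_forall_map_eq hm hX hind hW hψ hlaw .univ hS
  refine ⟨hmap, Indep_iff _ _ _ |>.mpr ?_⟩
  rintro _ A ⟨S, hS, rfl⟩ hA
  rw [measure_preimage_inter_of_forall_map_eq hm hX hind hW hψ hlaw hA hS, ← hmap,
    Measure.map_apply hY hS]

end Independence

section StrongLaw

variable {Ω : Type*} [mΩ : MeasurableSpace Ω] {P : Measure Ω}

theorem summable_inv_rpow_sq {ε : ℝ} (hε : 1 / 2 < ε) :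
    Summable fun k : ℕ => (((k : ℝ) ^ ε)⁻¹) ^ 2 := by
  refine (Real.summable_nat_rpow_inv.mpr (by linarith : 1 < ε * 2)).congr fun k => ?_
  rw [inv_pow, ← Real.rpow_mul_natCast k.cast_nonneg, Nat.cast_ofNat]

theorem ae_tendsto_zero_of_tsum_lintegral_sq_ne_top {f : ℕ → Ω → ℝ} (hf : ∀ k, Measurable (f k))
    (h : ∑' k, ∫⁻ ω, ENNReal.ofReal (f k ω ^ 2) ∂P ≠ ∞) :
    ∀ᵐ ω ∂P, Tendsto (fun k => f k ω) atTop (𝓝 0) := by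
  have hmeas (k : ℕ) : Measurable fun ω => ENNReal.ofReal (f k ω ^ 2) :=
    ((hf k).pow_const 2).ennreal_ofReal
  rw [← lintegral_tsum fun k => (hmeas k).aemeasurable] at h
  filter_upwards [ae_lt_top (.tsum hmeas) h] with ω hω
  have hsq : Tendsto (fun k => f k ω ^ 2) atTop (𝓝 0) := by
    simpa [Function.comp_def, sq_nonneg] using (ENNReal.tendsto_toReal ENNReal.zero_ne_top).comp
      (ENNReal.tendsto_atTop_zero_of_tsum_ne_top hω.ne)
  exact (tendsto_zero_iff_abs_tendsto_zero _).mpr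
    (by simpa [Function.comp_def, Real.sqrt_sq_eq_abs] using hsq.sqrt)

theorem ae_tendsto_inv_rpow_mul_of_lintegral_sq_le {D : ℕ → Ω → ℝ} (hD : ∀ k, Measurable (D k))
    {C : ℝ≥0∞} (hC : C ≠ ∞)
    (hDC : ∀ k ≠ 0, ∫⁻ ω, ENNReal.ofReal (D k ω ^ 2) ∂P ≤ C) {ε : ℝ} (hε : 1 / 2 < ε) :
    ∀ᵐ ω ∂P, Tendsto (fun k : ℕ => ((k : ℝ) ^ ε)⁻¹ * D k ω) atTop (𝓝 0) := by
  refine ae_tendsto_zero_of_tsum_lintegral_sq_ne_top (fun k => (hD k).const_mul _) ?_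
  have hle (k : ℕ) : ∫⁻ ω, ENNReal.ofReal ((((k : ℝ) ^ ε)⁻¹ * D k ω) ^ 2) ∂P ≤
      ENNReal.ofReal ((((k : ℝ) ^ ε)⁻¹) ^ 2) * C := by
    rcases eq_or_ne k 0 with rfl | hk
    · simp [Real.zero_rpow (by linarith : ε ≠ 0)]
    simp only [mul_pow, ENNReal.ofReal_mul (sq_nonneg ((k : ℝ) ^ ε)⁻¹)]
    rw [lintegral_const_mul' _ _ ENNReal.ofReal_ne_top]
    gcongr
    exact hDC k hk
  refine ne_top_of_le_ne_top ?_ (ENNReal.tsum_le_tsum hle)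
  rw [ENNReal.tsum_mul_right]
  exact ENNReal.mul_ne_top (summable_inv_rpow_sq hε).tsum_ofReal_ne_top hC

theorem pairwise_indepFun_of_filtration {β : Type*} [MeasurableSpace β] {ℱ : Filtration ℕ mΩ}
    {Y : ℕ → Ω → β} (hY : ∀ k, Measurable[ℱ (k + 1)] (Y k))
    (hind : ∀ k, Indep (MeasurableSpace.comap (Y k) inferInstance) (ℱ k) P) :
    Pairwise fun i j => IndepFun (Y i) (Y j) P := by
  have hlt {i j : ℕ} (hij : i < j) : IndepFun (Y j) (Y i) P :=
    indep_of_indep_of_le_right (hind j) ((hY i).comap_le.trans (ℱ.mono hij))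
  intro i j hij
  rcases hij.lt_or_gt with h | h
  exacts [(hlt h).symm, hlt h]

theorem martingale_sum_range_of_indep [IsFiniteMeasure P] {ℱ : Filtration ℕ mΩ} {Z : ℕ → Ω → ℝ}
    (hZ : ∀ k, Measurable[ℱ (k + 1)] (Z k))
    (hind : ∀ k, Indep (MeasurableSpace.comap (Z k) inferInstance) (ℱ k) P)
    (hint : ∀ k, Integrable (Z k) P) (hmean : ∀ k, ∫ ω, Z k ω ∂P = 0) :
    Martingale (fun k => ∑ i ∈ Finset.range k, Z i) ℱ P := by
  refine martingale_of_condExp_sub_eq_zero_nat (fun k => ?_)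
    (fun k => integrable_finsetSum' _ fun i _ => hint i) fun k => ?_
  · exact Finset.stronglyMeasurable_sum _ fun i hi =>
      ((hZ i).mono (ℱ.mono (Finset.mem_range.mp hi)) le_rfl).stronglyMeasurable
  · rw [Finset.sum_range_succ, add_sub_cancel_left]
    filter_upwards [condExp_indep_eq ((hZ k).mono (ℱ.le _) le_rfl).comap_le (ℱ.le k)
      (comap_measurable (Z k)).stronglyMeasurable (hind k)] with ω hω
    rw [hω, hmean, Pi.zero_apply]

theorem eLpNorm_one_le_sqrt_variance [IsProbabilityMeasure P] {f : Ω → ℝ} (hf : MemLp f 2 P)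
    (hmean : ∫ ω, f ω ∂P = 0) : eLpNorm f 1 P ≤ ENNReal.ofReal √(variance f P) :=
  calc eLpNorm f 1 P ≤ eLpNorm f 2 P :=
        eLpNorm_le_eLpNorm_of_exponent_le one_le_two hf.aestronglyMeasurable
    _ = ENNReal.ofReal √(variance f P) := by
        rw [hf.eLpNorm_eq_integral_rpow_norm two_ne_zero ENNReal.ofNat_ne_top,
          variance_of_integral_eq_zero hf.aestronglyMeasurable.aemeasurable hmean,
          Real.sqrt_eq_rpow]
        simp

/-- Kolmogorov's convergence theorem. -/
theorem ae_exists_tendsto_sum_range_of_summable_variance [IsProbabilityMeasure P]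
    {ℱ : Filtration ℕ mΩ} {Z : ℕ → Ω → ℝ} (hZ : ∀ k, Measurable[ℱ (k + 1)] (Z k))
    (hind : ∀ k, Indep (MeasurableSpace.comap (Z k) inferInstance) (ℱ k) P)
    (hL2 : ∀ k, MemLp (Z k) 2 P) (hmean : ∀ k, ∫ ω, Z k ω ∂P = 0)
    (hvar : Summable fun k => variance (Z k) P) :
    ∀ᵐ ω ∂P, ∃ l, Tendsto (fun k => ∑ i ∈ Finset.range k, Z i ω) atTop (𝓝 l) := by
  have hint (k : ℕ) : Integrable (Z k) P := (hL2 k).integrable one_le_two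
  have hbdd (k : ℕ) : eLpNorm (∑ i ∈ Finset.range k, Z i) 1 P ≤
      (√(∑' k, variance (Z k) P)).toNNReal := by
    refine (eLpNorm_one_le_sqrt_variance (memLp_finsetSum' _ fun i _ => hL2 i) ?_).trans ?_
    · simp only [Finset.sum_apply]
      rw [integral_finsetSum _ fun i _ => hint i]
      simp [hmean]
    · refine ENNReal.ofReal_le_ofReal (Real.sqrt_le_sqrt ?_)
      rw [IndepFun.variance_sum (fun i _ => hL2 i)
        fun i _ j _ hij => pairwise_indepFun_of_filtration hZ hind hij]
      exact hvar.sum_le_tsum _ fun i _ => variance_nonneg _ _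
  simpa only [Finset.sum_apply] using
    (martingale_sum_range_of_indep hZ hind hint hmean).submartingale.exists_ae_tendsto_of_bdd hbdd

theorem ae_tendsto_inv_rpow_mul_sum_sub [IsProbabilityMeasure P] {ℱ : Filtration ℕ mΩ}
    {Y : ℕ → Ω → ℝ} (hY : ∀ k, Measurable[ℱ (k + 1)] (Y k))
    (hind : ∀ k, Indep (MeasurableSpace.comap (Y k) inferInstance) (ℱ k) P)
    (hid : ∀ k, IdentDistrib (Y k) (Y 0) P P) (hL2 : MemLp (Y 0) 2 P) {ε : ℝ} (hε : 1 / 2 < ε) :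
    ∀ᵐ ω ∂P, Tendsto (fun k : ℕ => ((k : ℝ) ^ ε)⁻¹ *
      (∑ i ∈ Finset.range k, Y i ω - k * ∫ ω, Y 0 ω ∂P)) atTop (𝓝 0) := by
  set c := ∫ ω, Y 0 ω ∂P
  set a : ℕ → ℝ := fun k => (k : ℝ) ^ ε
  set Z : ℕ → Ω → ℝ := fun k ω => (a (k + 1))⁻¹ * (Y k ω - c)
  have haff (k : ℕ) : Measurable fun y : ℝ => (a (k + 1))⁻¹ * (y - c) := by fun_prop
  have hYL2 (k : ℕ) : MemLp (Y k) 2 P := (hid k).memLp_iff.mpr hL2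
  have hvar (k : ℕ) : variance (Z k) P = (a (k + 1))⁻¹ ^ 2 * variance (Y 0) P := by
    rw [variance_const_mul, variance_sub_const (hYL2 k).aestronglyMeasurable, (hid k).variance_eq]
  have hmean (k : ℕ) : ∫ ω, Z k ω ∂P = 0 := by
    rw [integral_const_mul, integral_sub ((hYL2 k).integrable one_le_two) (integrable_const c),
      (hid k).integral_eq]
    simp [c]
  have hsummable : Summable fun k => variance (Z k) P := by
    simp only [hvar]
    exact ((summable_nat_add_iff 1).mpr (summable_inv_rpow_sq hε)).mul_right _
  have hε0 : 0 < ε := by linarith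
  filter_upwards [ae_exists_tendsto_sum_range_of_summable_variance (ℱ := ℱ)
    (fun k => (haff k).comp (hY k))
    (fun k => indep_of_indep_of_le_left (hind k)
      ((haff k).comp (comap_measurable (Y k))).comap_le)
    (fun k => ((hYL2 k).sub (memLp_const c)).const_mul _) hmean hsummable] with ω ⟨l, hl⟩
  have hlim := tendsto_inv_smul_sum_of_tendsto_sum_inv_smul (a := a) (y := fun i => Y i ω - c)
    (fun i j hij => by dsimp only [a]; gcongr)
    ((tendsto_rpow_atTop hε0).comp tendsto_natCast_atTop_atTop)
    (fun i => by dsimp only [a]; positivity) hl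
  simpa [Finset.sum_sub_distrib] using hlim

end StrongLaw

section Biinvariance

variable {𝔽 : Type*} [NormedDivisionRing 𝔽] {q : ℕ}

theorem measurable_GL_val :
    Measurable fun g : GL (Fin q) 𝔽 => (g : Matrix (Fin q) (Fin q) 𝔽) :=
  comap_measurable _

variable [StarRing 𝔽]

theorem star_val_star_toUnits_mul (u : UnitaryGroup 𝔽 q) (g : GL (Fin q) 𝔽) :
    star ((Unitary.toUnits (star u) * g : GL (Fin q) 𝔽) : Matrix (Fin q) (Fin q) 𝔽) =
      star (g : Matrix (Fin q) (Fin q) 𝔽) * (u : Matrix (Fin q) (Fin q) 𝔽) := by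
  simp

/-- Invariance of a measure on `GL(q, 𝔽)` under left multiplication by unitary matrices, one half
of biinvariance. -/
def IsLeftUnitaryInvariant (μ : Measure (GL (Fin q) 𝔽)) : Prop :=
  ∀ u : UnitaryGroup 𝔽 q, μ.map (fun g => Unitary.toUnits u * g) = μ

variable {μ ν : Measure (GL (Fin q) 𝔽)}

theorem IsBiinvariant.isLeftUnitaryInvariant (h : IsBiinvariant μ) :
    IsLeftUnitaryInvariant μ := fun u => by
  simpa using h u 1

variable [NormedAlgebra ℝ 𝔽]

theorem logSingularSpectrum_unitary_mul (u : UnitaryGroup 𝔽 q) (g : GL (Fin q) 𝔽) :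
    logSingularSpectrum (Unitary.toUnits u * g) = logSingularSpectrum g := by
  have hgram : star ((Unitary.toUnits u * g : GL (Fin q) 𝔽) : Matrix (Fin q) (Fin q) 𝔽) *
      ((Unitary.toUnits u * g : GL (Fin q) 𝔽) : Matrix (Fin q) (Fin q) 𝔽) =
      star (g : Matrix (Fin q) (Fin q) 𝔽) * (g : Matrix (Fin q) (Fin q) 𝔽) := by
    rw [Units.val_mul, Unitary.val_toUnits_apply, star_mul, mul_assoc,
      ← mul_assoc (star (u : Matrix (Fin q) (Fin q) 𝔽)), Unitary.star_mul_self_of_mem u.2, one_mul]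
  ext j
  simp only [logSingularSpectrum, singularSpectrum, hgram]

variable [IsRealComplexOrQuaternion 𝔽]

instance instMeasurableMul₂GL : MeasurableMul₂ (GL (Fin q) 𝔽) where
  measurable_mul := measurable_comap_iff.mpr
    ((measurable_GL_val.comp measurable_fst).mul (measurable_GL_val.comp measurable_snd))

theorem measurable_star_GL_val :
    Measurable fun g : GL (Fin q) 𝔽 => star (g : Matrix (Fin q) (Fin q) 𝔽) :=
  continuous_star.measurable.comp measurable_GL_val

theorem measurable_logMinor_star :
    Measurable fun g : GL (Fin q) 𝔽 => logMinor (star (g : Matrix (Fin q) (Fin q) 𝔽)) :=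
  measurable_logMinor.comp measurable_star_GL_val

theorem measurable_logMinor_star_mul :
    Measurable fun p : UnitaryGroup 𝔽 q × GL (Fin q) 𝔽 =>
      logMinor (star (p.2 : Matrix (Fin q) (Fin q) 𝔽) * (p.1 : Matrix (Fin q) (Fin q) 𝔽)) :=
  measurable_logMinor.comp ((measurable_star_GL_val.comp measurable_snd).mul
    (measurable_subtype_coe.comp measurable_fst))

variable (𝔽) in
theorem exists_lintegral_sq_partialSum_sub_logMinor_star_le (r : Fin q) :
    ∃ C : ℝ≥0∞, C ≠ ∞ ∧ ∀ μ : Measure (GL (Fin q) 𝔽), IsProbabilityMeasure μ →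
      IsLeftUnitaryInvariant μ →
      ∫⁻ g, ENNReal.ofReal ((partialSum (logSingularSpectrum g) r -
        logMinor (star (g : Matrix (Fin q) (Fin q) 𝔽)) r) ^ 2) ∂μ ≤ C := by
  obtain ⟨C, hC, hbound⟩ := exists_lintegral_sq_partialSum_sub_logMinor_star_mul_le 𝔽 r
  refine ⟨C, hC, fun μ _ hμ => ?_⟩
  set f : UnitaryGroup 𝔽 q → GL (Fin q) 𝔽 → ℝ≥0∞ := fun u g =>
    ENNReal.ofReal ((partialSum (logSingularSpectrum g) r -
      logMinor (star (g : Matrix (Fin q) (Fin q) 𝔽) * (u : Matrix (Fin q) (Fin q) 𝔽)) r) ^ 2)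
    with hf
  have hfm : Measurable (Function.uncurry f) :=
    ((((measurable_partialSum_logSingularSpectrum r).comp measurable_snd).sub
      (measurable_logMinor_star_mul.eval (a := r))).pow_const 2).ennreal_ofReal
  have hshift (u : UnitaryGroup 𝔽 q) : ∫⁻ g, f 1 g ∂μ = ∫⁻ g, f u g ∂μ := by
    conv_lhs => rw [← hμ (star u),
      lintegral_map hfm.of_uncurry_left (measurable_const_mul _)]
    simp only [hf, logSingularSpectrum_unitary_mul, star_val_star_toUnits_mul, OneMemClass.coe_one,
      mul_one]
  calc ∫⁻ g, ENNReal.ofReal ((partialSum (logSingularSpectrum g) r -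
        logMinor (star (g : Matrix (Fin q) (Fin q) 𝔽)) r) ^ 2) ∂μ
      = ∫⁻ g, f 1 g ∂μ := by simp only [hf, OneMemClass.coe_one, mul_one]
    _ = ∫⁻ u, ∫⁻ g, f u g ∂μ ∂haarUnitary 𝔽 q := by simp [← hshift]
    _ = ∫⁻ g, ∫⁻ u, f u g ∂haarUnitary 𝔽 q ∂μ := lintegral_lintegral_swap hfm.aemeasurable
    _ ≤ ∫⁻ _, C ∂μ := lintegral_mono hbound
    _ = C := by simp

namespace IsLeftUnitaryInvariant

theorem mconv [SFinite μ] [SFinite ν] (hμ : IsLeftUnitaryInvariant μ) :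
    IsLeftUnitaryInvariant (μ.mconv ν) := fun u => by
  have hu : Measurable fun g : GL (Fin q) 𝔽 => Unitary.toUnits u * g := measurable_const_mul _
  conv_rhs => rw [Measure.mconv, ← hμ u, ← Measure.map_id (μ := ν),
    Measure.map_prod_map _ _ hu measurable_id,
    Measure.map_map measurable_mul (hu.prodMap measurable_id)]
  rw [Measure.mconv, Measure.map_map hu measurable_mul]
  congr 1 with p
  simp [mul_assoc]

theorem integral_logMinor_star [SFinite μ] (hμ : IsLeftUnitaryInvariant μ)
    (hint : ∀ j, Integrable (fun g => logSingularSpectrum g j) μ) :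
    ∫ g, logMinor (star (g : Matrix (Fin q) (Fin q) 𝔽)) ∂μ =
      ∫ g, meanLogMinor 𝔽 (logSingularSpectrum g) ∂μ := by
  have hshift (u : UnitaryGroup 𝔽 q) :
      ∫ g, logMinor (star (g : Matrix (Fin q) (Fin q) 𝔽)) ∂μ =
        ∫ g, logMinor (star (g : Matrix (Fin q) (Fin q) 𝔽) *
          (u : Matrix (Fin q) (Fin q) 𝔽)) ∂μ := by
    conv_lhs => rw [← hμ (star u), integral_map (measurable_const_mul _).aemeasurable
      measurable_logMinor_star.aestronglyMeasurable]
    simp only [star_val_star_toUnits_mul]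
  have hprod : Integrable (Function.uncurry fun (u : UnitaryGroup 𝔽 q) (g : GL (Fin q) 𝔽) =>
      logMinor (star (g : Matrix (Fin q) (Fin q) 𝔽) * (u : Matrix (Fin q) (Fin q) 𝔽)))
      ((haarUnitary 𝔽 q).prod μ) :=
    (((integrable_finsetSum _ fun i _ => (hint i).abs).const_mul (q : ℝ)).comp_snd _).mono'
      measurable_logMinor_star_mul.aestronglyMeasurable
      (ae_of_all _ fun p => norm_logMinor_star_mul_le p.2 p.1)
  calc ∫ g, logMinor (star (g : Matrix (Fin q) (Fin q) 𝔽)) ∂μ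
      = ∫ u : UnitaryGroup 𝔽 q, ∫ g, logMinor (star (g : Matrix (Fin q) (Fin q) 𝔽) *
          (u : Matrix (Fin q) (Fin q) 𝔽)) ∂μ ∂haarUnitary 𝔽 q := by simp [← hshift]
    _ = ∫ g, ∫ u : UnitaryGroup 𝔽 q, logMinor (star (g : Matrix (Fin q) (Fin q) 𝔽) *
          (u : Matrix (Fin q) (Fin q) 𝔽)) ∂haarUnitary 𝔽 q ∂μ := integral_integral_swap hprod
    _ = ∫ g, meanLogMinor 𝔽 (logSingularSpectrum g) ∂μ := by
        simp only [integral_logMinor_star_mul]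

theorem map_logMinor_star_mul_sub (hμ : IsLeftUnitaryInvariant μ)
    {s : Matrix (Fin q) (Fin q) 𝔽} (hs : IsUnit s) :
    μ.map (fun g : GL (Fin q) 𝔽 =>
        logMinor (star (g : Matrix (Fin q) (Fin q) 𝔽) * s) - logMinor s) =
      μ.map fun g : GL (Fin q) 𝔽 => logMinor (star (g : Matrix (Fin q) (Fin q) 𝔽)) := by
  obtain ⟨u, hu⟩ := exists_unitary_logMinor_mul hs
  conv_rhs => rw [← hμ (star u),
    Measure.map_map measurable_logMinor_star (measurable_const_mul _)]
  congr 1 with g : 1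
  rw [Function.comp_apply, star_val_star_toUnits_mul, hu _ g.isUnit.star, add_sub_cancel_right]

end IsLeftUnitaryInvariant

end Biinvariance

section StrictPast

variable {Ω β : Type*} [mΩ : MeasurableSpace Ω] [MeasurableSpace β] {X : ℕ → Ω → β}
  (hX : ∀ k, Measurable (X k))

/-- The filtration whose `k`-th sigma-algebra is generated by `X i` for `i < k`. It is the natural
filtration of a random walk starting at time `0` with first increment `X 0`. -/
def strictPast : Filtration ℕ mΩ where
  seq k := ⨆ i ∈ Set.Iio k, MeasurableSpace.comap (X i) inferInstance
  mono' _ _ hkl := biSup_mono fun _ hi => lt_of_lt_of_le hi hkl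
  le' _ := iSup₂_le fun i _ => (hX i).comap_le

theorem measurable_strictPast_of_lt {i k : ℕ} (hik : i < k) :
    Measurable[strictPast hX k] (X i) :=
  (comap_measurable (X i)).mono
    (le_iSup₂ (f := fun i (_ : i ∈ Set.Iio k) => MeasurableSpace.comap (X i) inferInstance) i hik)
    le_rfl

theorem indep_strictPast {P : Measure Ω} (hindep : iIndepFun X P) (k : ℕ) :
    Indep (strictPast hX k) (MeasurableSpace.comap (X k) inferInstance) P := by
  have hdisj : Disjoint (Set.Iio k) {k} := by simp
  simpa using! indep_iSup_of_disjoint (fun i => (hX i).comap_le) hindep hdisj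

end StrictPast

section Walk

variable {𝔽 : Type*} [NormedDivisionRing 𝔽] [NormedAlgebra ℝ 𝔽] [StarRing 𝔽]
  [IsRealComplexOrQuaternion 𝔽] {q : ℕ} {Ω : Type*} {X : ℕ → Ω → GL (Fin q) 𝔽}

variable (X) in
/-- The increments of `logMinor` along the walk `S_k^* = X_k^* ⋯ X_1^*`. -/
def logMinorIncr (k : ℕ) (ω : Ω) : Fin q → ℝ :=
  logMinor (star (walk X (k + 1) ω : Matrix (Fin q) (Fin q) 𝔽)) -
    logMinor (star (walk X k ω : Matrix (Fin q) (Fin q) 𝔽))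

theorem sum_range_logMinorIncr (k : ℕ) (ω : Ω) :
    ∑ i ∈ Finset.range k, logMinorIncr X i ω =
      logMinor (star (walk X k ω : Matrix (Fin q) (Fin q) 𝔽)) := by
  have hone : logMinor (star (walk X 0 ω : Matrix (Fin q) (Fin q) 𝔽)) = 0 := by
    simpa [walk] using logMinor_unitary (1 : UnitaryGroup 𝔽 q)
  simp only [logMinorIncr]
  rw [Finset.sum_range_sub fun i => logMinor (star (walk X i ω : Matrix (Fin q) (Fin q) 𝔽)), hone,
    sub_zero]

variable [mΩ : MeasurableSpace Ω] (hX : ∀ k, Measurable (X k))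

theorem measurable_strictPast_walk (k : ℕ) : Measurable[strictPast hX k] (walk X k) := by
  induction k with
  | zero => exact measurable_const
  | succ k ih =>
    exact (ih.mono ((strictPast hX).mono k.le_succ) le_rfl).mul
      (measurable_strictPast_of_lt hX k.lt_succ_self)

include hX in
theorem measurable_walk (k : ℕ) : Measurable (walk X k) :=
  (measurable_strictPast_walk hX k).mono ((strictPast hX).le k) le_rfl

theorem measurable_logMinorIncr (k : ℕ) :
    Measurable[strictPast hX (k + 1)] (logMinorIncr X k) :=
  (measurable_logMinor_star.comp (measurable_strictPast_walk hX (k + 1))).sub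
    (measurable_logMinor_star.comp
      ((measurable_strictPast_walk hX k).mono ((strictPast hX).mono k.le_succ) le_rfl))

variable {P : Measure Ω} [IsProbabilityMeasure P] {νG : Measure (GL (Fin q) 𝔽)}
  (hνG : IsLeftUnitaryInvariant νG) (hlaw : ∀ k, P.map (X k) = νG) (hindep : iIndepFun X P)
include hνG hlaw hindep

include hX in
theorem isLeftUnitaryInvariant_map_walk {k : ℕ} (hk : k ≠ 0) :
    IsLeftUnitaryInvariant (P.map (walk X k)) := by
  induction k, Nat.one_le_iff_ne_zero.mpr hk using Nat.le_induction with
  | base => simpa [walk, hlaw] using hνG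
  | succ k _ ih =>
    have hind : IndepFun (walk X k) (X k) P :=
      indep_of_indep_of_le_left (indep_strictPast hX hindep k)
        (measurable_strictPast_walk hX k).comap_le
    have hconv : P.map (walk X (k + 1)) = (P.map (walk X k)).mconv (P.map (X k)) :=
      hind.map_mul_eq_map_mconv_map (measurable_walk hX k) (hX k)
    rw [hconv]
    exact (ih (Nat.one_le_iff_ne_zero.mp ‹1 ≤ k›)).mconv

theorem map_eq_and_indep_logMinorIncr (k : ℕ) :
    P.map (logMinorIncr X k) =
        νG.map (fun g : GL (Fin q) 𝔽 =>
          logMinor (star (g : Matrix (Fin q) (Fin q) 𝔽))) ∧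
      Indep (MeasurableSpace.comap (logMinorIncr X k) inferInstance) (strictPast hX k) P := by
  set ψ : GL (Fin q) 𝔽 → GL (Fin q) 𝔽 → Fin q → ℝ := fun x w =>
    logMinor (star (x : Matrix (Fin q) (Fin q) 𝔽) * star (w : Matrix (Fin q) (Fin q) 𝔽)) -
      logMinor (star (w : Matrix (Fin q) (Fin q) 𝔽))
  have hψ : Measurable (Function.uncurry ψ) :=
    (measurable_logMinor.comp ((measurable_star_GL_val.comp measurable_fst).mul
      (measurable_star_GL_val.comp measurable_snd))).sub
      (measurable_logMinor_star.comp measurable_snd)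
  have hincr : logMinorIncr X k = fun ω => ψ (X k ω) (walk X k ω) := by
    ext ω : 1
    simp only [logMinorIncr, walk, Units.val_mul, star_mul, ψ]
  rw [hincr]
  refine map_eq_and_indep_of_forall_map_eq ((strictPast hX).le k) (hX k)
    (indep_strictPast hX hindep k) (measurable_strictPast_walk hX k) hψ fun ω => ?_
  rw [hlaw]
  exact hνG.map_logMinor_star_mul_sub (walk X k ω).isUnit.star

include hX

theorem identDistrib_logMinorIncr (k : ℕ) :
    IdentDistrib (logMinorIncr X k)
      (fun g : GL (Fin q) 𝔽 => logMinor (star (g : Matrix (Fin q) (Fin q) 𝔽))) P νG where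
  aemeasurable_fst :=
    ((measurable_logMinorIncr hX k).mono ((strictPast hX).le _) le_rfl).aemeasurable
  aemeasurable_snd := measurable_logMinor_star.aemeasurable
  map_eq := (map_eq_and_indep_logMinorIncr hX hνG hlaw hindep k).1

theorem identDistrib_logMinorIncr_zero (k : ℕ) :
    IdentDistrib (logMinorIncr X k) (logMinorIncr X 0) P P :=
  (identDistrib_logMinorIncr hX hνG hlaw hindep k).trans
    (identDistrib_logMinorIncr hX hνG hlaw hindep 0).symm

theorem ae_tendsto_partialSum_sub_logMinor_star {ε : ℝ} (hε : 1 / 2 < ε) (r : Fin q) :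
    ∀ᵐ ω ∂P, Tendsto (fun k : ℕ => ((k : ℝ) ^ ε)⁻¹ *
      (partialSum (logSingularSpectrum (walk X k ω)) r -
        logMinor (star (walk X k ω : Matrix (Fin q) (Fin q) 𝔽)) r)) atTop (𝓝 0) := by
  obtain ⟨C, hC, hbound⟩ := exists_lintegral_sq_partialSum_sub_logMinor_star_le 𝔽 r
  have hdefect : Measurable fun g : GL (Fin q) 𝔽 => partialSum (logSingularSpectrum g) r -
      logMinor (star (g : Matrix (Fin q) (Fin q) 𝔽)) r :=
    (measurable_partialSum_logSingularSpectrum r).sub (measurable_logMinor_star.eval (a := r))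
  refine ae_tendsto_inv_rpow_mul_of_lintegral_sq_le
    (fun k => hdefect.comp (measurable_walk hX k)) hC (fun k hk => ?_) hε
  have := hbound (P.map (walk X k))
    (Measure.isProbabilityMeasure_map (measurable_walk hX k).aemeasurable)
    (isLeftUnitaryInvariant_map_walk hX hνG hlaw hindep hk)
  rwa [lintegral_map (hdefect.pow_const 2).ennreal_ofReal (measurable_walk hX k)] at this

end Walk

section Moments

variable {𝔽 : Type*} [NormedDivisionRing 𝔽] [NormedAlgebra ℝ 𝔽] [StarRing 𝔽]
  [IsRealComplexOrQuaternion 𝔽] {q : ℕ}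

section RadialMeasure

variable {ν : Measure (Fin q → ℝ)}

theorem AdmitsFirstMoments.integrable_meanLogMinor (h : AdmitsFirstMoments ν) :
    Integrable (meanLogMinor 𝔽) ν :=
  ((integrable_finsetSum _ fun i _ => (h i).abs).const_mul (q : ℝ)).mono'
    stronglyMeasurable_meanLogMinor.aestronglyMeasurable (ae_of_all _ norm_meanLogMinor_le)

theorem AdmitsFirstMoments.integrable_momentFunction (h : AdmitsFirstMoments ν) (j : Fin q) :
    Integrable (fun t => momentFunction 𝔽 t j) ν := by
  simp only [momentFunction_eq_incr_meanLogMinor]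
  exact (incr.integrable_comp h.integrable_meanLogMinor).eval j

theorem AdmitsFirstMoments.dispersion_eq (h : AdmitsFirstMoments ν) :
    dispersion 𝔽 ν = incr (∫ t, meanLogMinor 𝔽 t ∂ν) := by
  ext j
  simp only [dispersion, momentFunction_eq_incr_meanLogMinor]
  rw [← incr.integral_comp_comm h.integrable_meanLogMinor,
    eval_integral fun i => (incr.integrable_comp h.integrable_meanLogMinor).eval i]

theorem AdmitsFirstMoments.memLp (h : AdmitsFirstMoments ν) (j : Fin q) :
    MemLp (fun t : Fin q → ℝ => t j) 1 ν :=
  memLp_one_iff_integrable.mpr (h j)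

theorem AdmitsSecondMoments.memLp (h : AdmitsSecondMoments ν) (j : Fin q) :
    MemLp (fun t : Fin q → ℝ => t j) 2 ν :=
  (memLp_two_iff_integrable_sq (measurable_pi_apply j).aestronglyMeasurable).mpr (h j)

theorem AdmitsSecondMoments.admitsFirstMoments [IsFiniteMeasure ν] (h : AdmitsSecondMoments ν) :
    AdmitsFirstMoments ν :=
  fun j => (h.memLp j).integrable one_le_two

end RadialMeasure

variable {μ : Measure (GL (Fin q) 𝔽)}

theorem memLp_logMinor_star {p : ℝ≥0∞}
    (h : ∀ j, MemLp (fun t : Fin q → ℝ => t j) p (radialPart μ)) :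
    MemLp (fun g : GL (Fin q) 𝔽 => logMinor (star (g : Matrix (Fin q) (Fin q) 𝔽))) p μ := by
  have hcoord (j : Fin q) : MemLp (fun g : GL (Fin q) 𝔽 => logSingularSpectrum g j) p μ :=
    (h j).comp_of_map measurable_logSingularSpectrum.aemeasurable
  exact ((memLp_finsetSum _ fun i _ => (hcoord i).abs).const_mul (q : ℝ)).mono'
    measurable_logMinor_star.aestronglyMeasurable
    (ae_of_all _ fun g => by simpa using norm_logMinor_star_mul_le g 1)

theorem incr_integral_logMinor_star_eq_dispersion [SFinite μ] (hμ : IsLeftUnitaryInvariant μ)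
    (h : AdmitsFirstMoments (radialPart μ)) :
    incr (∫ g : GL (Fin q) 𝔽, logMinor (star (g : Matrix (Fin q) (Fin q) 𝔽)) ∂μ) =
      dispersion 𝔽 (radialPart μ) := by
  have hspec : AEMeasurable (logSingularSpectrum : GL (Fin q) 𝔽 → Fin q → ℝ) μ :=
    measurable_logSingularSpectrum.aemeasurable
  rw [h.dispersion_eq, hμ.integral_logMinor_star fun j => (h j).comp_aemeasurable hspec,
    radialPart, integral_map hspec stronglyMeasurable_meanLogMinor.aestronglyMeasurable]

end Moments

section LimitTheorems

variable {𝔽 : Type*} [NormedDivisionRing 𝔽] [NormedAlgebra ℝ 𝔽] [StarRing 𝔽]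
  [IsRealComplexOrQuaternion 𝔽] {q : ℕ} {Ω : Type*} [MeasurableSpace Ω] {P : Measure Ω}
  [IsProbabilityMeasure P] {νG : Measure (GL (Fin q) 𝔽)} {X : ℕ → Ω → GL (Fin q) 𝔽}
  (hX : ∀ k, Measurable (X k)) (hνG : IsLeftUnitaryInvariant νG)
  (hlaw : ∀ k, P.map (X k) = νG) (hindep : iIndepFun X P)
include hX hνG hlaw hindep

theorem ae_tendsto_logSingularSpectrum_sub_incr_logMinor_star {ε : ℝ} (hε : 1 / 2 < ε) :
    ∀ᵐ ω ∂P, Tendsto (fun k : ℕ => ((k : ℝ) ^ ε)⁻¹ • (logSingularSpectrum (walk X k ω) -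
      incr (logMinor (star (walk X k ω : Matrix (Fin q) (Fin q) 𝔽))))) atTop (𝓝 0) := by
  filter_upwards [ae_all_iff.mpr fun r =>
    ae_tendsto_partialSum_sub_logMinor_star hX hνG hlaw hindep hε r] with ω hω
  have hvec : Tendsto (fun k : ℕ => ((k : ℝ) ^ ε)⁻¹ •
      (partialSum (logSingularSpectrum (walk X k ω)) -
        logMinor (star (walk X k ω : Matrix (Fin q) (Fin q) 𝔽)))) atTop (𝓝 0) :=
    tendsto_pi_nhds.mpr hω
  simpa [Function.comp_def, incr_partialSum] using (incr.continuous.tendsto 0).comp hvec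

theorem ae_tendsto_inv_smul_logMinor_star
    (hint : Integrable (fun g : GL (Fin q) 𝔽 =>
      logMinor (star (g : Matrix (Fin q) (Fin q) 𝔽))) νG) :
    ∀ᵐ ω ∂P, Tendsto (fun k : ℕ => (k : ℝ)⁻¹ •
        logMinor (star (walk X k ω : Matrix (Fin q) (Fin q) 𝔽))) atTop
      (𝓝 (∫ g : GL (Fin q) 𝔽, logMinor (star (g : Matrix (Fin q) (Fin q) 𝔽)) ∂νG)) := by
  have hid := identDistrib_logMinorIncr hX hνG hlaw hindep 0
  have hpair : Pairwise fun i j => IndepFun (logMinorIncr X i) (logMinorIncr X j) P :=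
    pairwise_indepFun_of_filtration (measurable_logMinorIncr hX)
      fun k => (map_eq_and_indep_logMinorIncr hX hνG hlaw hindep k).2
  have hlln := strong_law_ae (logMinorIncr X) (hid.integrable_iff.mpr hint) hpair
    (identDistrib_logMinorIncr_zero hX hνG hlaw hindep)
  simpa only [sum_range_logMinorIncr, hid.integral_eq] using hlln

theorem ae_tendsto_inv_rpow_smul_logMinor_star_sub
    (hL2 : MemLp (fun g : GL (Fin q) 𝔽 =>
      logMinor (star (g : Matrix (Fin q) (Fin q) 𝔽))) 2 νG) {ε : ℝ} (hε : 1 / 2 < ε) :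
    ∀ᵐ ω ∂P, Tendsto (fun k : ℕ => ((k : ℝ) ^ ε)⁻¹ •
        (logMinor (star (walk X k ω : Matrix (Fin q) (Fin q) 𝔽)) - (k : ℝ) •
          ∫ g : GL (Fin q) 𝔽, logMinor (star (g : Matrix (Fin q) (Fin q) 𝔽)) ∂νG)) atTop
      (𝓝 0) := by
  have hid := identDistrib_logMinorIncr hX hνG hlaw hindep 0
  have hL2' : MemLp (logMinorIncr X 0) 2 P := hid.memLp_iff.mpr hL2
  have hcoord (r : Fin q) := ae_tendsto_inv_rpow_mul_sum_sub
    (fun k => (measurable_pi_apply r).comp (measurable_logMinorIncr hX k))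
    (fun k => indep_of_indep_of_le_left (map_eq_and_indep_logMinorIncr hX hνG hlaw hindep k).2
      ((measurable_pi_apply r).comp (comap_measurable (logMinorIncr X k))).comap_le)
    (fun k => (identDistrib_logMinorIncr_zero hX hνG hlaw hindep k).comp (measurable_pi_apply r))
    (hL2'.eval r) hε
  filter_upwards [ae_all_iff.mpr hcoord] with ω hω
  refine tendsto_pi_nhds.mpr fun r => (hω r).congr fun k => ?_
  have hint := hL2'.integrable one_le_two
  rw [← hid.integral_eq, ← sum_range_logMinorIncr]
  simp [Finset.sum_apply, eval_integral fun i => hint.eval i]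

end LimitTheorems

end BiinvariantWalk

end

theorem theorem2p4_general {𝔽 : Type*} [NormedDivisionRing 𝔽] [NormedAlgebra ℝ 𝔽] [StarRing 𝔽]
    [IsRealComplexOrQuaternion 𝔽] {q : ℕ} {Ω : Type*} [MeasurableSpace Ω] (P : Measure Ω)
    [IsProbabilityMeasure P] (νG : Measure (GL (Fin q) 𝔽)) (hνG : IsLeftUnitaryInvariant νG)
    (X : ℕ → Ω → GL (Fin q) 𝔽) (hX : ∀ k, Measurable (X k))
    (hlaw : ∀ k, P.map (X k) = νG) (hindep : iIndepFun X P) :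
    (AdmitsFirstMoments (radialPart νG) →
      (∀ j, Integrable (fun t => momentFunction 𝔽 t j) (radialPart νG)) ∧
      ∀ᵐ ω ∂P, Tendsto (fun k : ℕ => (k : ℝ)⁻¹ • logSingularSpectrum (walk X k ω)) atTop
        (𝓝 (dispersion 𝔽 (radialPart νG)))) ∧
    (AdmitsSecondMoments (radialPart νG) → ∀ ε : ℝ, 1 / 2 < ε →
      ∀ᵐ ω ∂P, Tendsto (fun k : ℕ => ((k : ℝ) ^ ε)⁻¹ •
        (logSingularSpectrum (walk X k ω) - (k : ℝ) • dispersion 𝔽 (radialPart νG))) atTop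
        (𝓝 0)) := by
  have : IsProbabilityMeasure νG :=
    hlaw 0 ▸ Measure.isProbabilityMeasure_map (hX 0).aemeasurable
  refine ⟨fun h1 => ⟨h1.integrable_momentFunction, ?_⟩, fun h2 ε hε => ?_⟩
  · filter_upwards [
      ae_tendsto_logSingularSpectrum_sub_incr_logMinor_star hX hνG hlaw hindep one_half_lt_one,
      ae_tendsto_inv_smul_logMinor_star hX hνG hlaw hindep
        (memLp_one_iff_integrable.mp (memLp_logMinor_star h1.memLp))] with ω hdefect hlln
    rw [← incr_integral_logMinor_star_eq_dispersion hνG h1]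
    simpa [Function.comp_def, smul_sub] using hdefect.add ((incr.continuous.tendsto _).comp hlln)
  · have : IsProbabilityMeasure (radialPart νG) :=
      Measure.isProbabilityMeasure_map measurable_logSingularSpectrum.aemeasurable
    filter_upwards [
      ae_tendsto_logSingularSpectrum_sub_incr_logMinor_star hX hνG hlaw hindep hε,
      ae_tendsto_inv_rpow_smul_logMinor_star_sub hX hνG hlaw hindep
        (memLp_logMinor_star h2.memLp) hε] with ω hdefect hfluct
    rw [← incr_integral_logMinor_star_eq_dispersion hνG h2.admitsFirstMoments]
    simpa [Function.comp_def, smul_sub] using hdefect.add ((incr.continuous.tendsto _).comp hfluct)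

theorem theorem2p4 {𝔽 : Type*} [NormedDivisionRing 𝔽] [NormedAlgebra ℝ 𝔽] [StarRing 𝔽]
    [IsRealComplexOrQuaternion 𝔽] {q : ℕ} (hq : 2 ≤ q)
    {Ω : Type*} [MeasurableSpace Ω] (P : Measure Ω) [IsProbabilityMeasure P]
    (νG : Measure (GL (Fin q) 𝔽)) (hνG : IsBiinvariant νG)
    (X : ℕ → Ω → GL (Fin q) 𝔽) (hX : ∀ k, Measurable (X k))
    (hlaw : ∀ k, P.map (X k) = νG) (hindep : iIndepFun X P) :
    (AdmitsFirstMoments (radialPart νG) →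
      (∀ j, Integrable (fun t => momentFunction 𝔽 t j) (radialPart νG)) ∧
      ∀ᵐ ω ∂P, Tendsto (fun k : ℕ => (k : ℝ)⁻¹ • logSingularSpectrum (walk X k ω)) atTop
        (𝓝 (dispersion 𝔽 (radialPart νG)))) ∧
    (AdmitsSecondMoments (radialPart νG) → ∀ ε : ℝ, 1 / 2 < ε →
      ∀ᵐ ω ∂P, Tendsto (fun k : ℕ => ((k : ℝ) ^ ε)⁻¹ •
        (logSingularSpectrum (walk X k ω) - (k : ℝ) • dispersion 𝔽 (radialPart νG))) atTop
        (𝓝 0)) :=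
  theorem2p4_general P νG hνG.isLeftUnitaryInvariant X hX hlaw hindep
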